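/- Let $G$ be a finite group. A $G$-Tambara functor $R$ assigns a commutative ring $R(X)$ to every finite $G$-set $X$, and to every $G$-equivariant map $f : X \to Y$ a ring homomorphism $f^* : R(Y) \to R(X)$ (restriction), an additive map $f_+ : R(X) \to R(Y)$ (transfer) and a multiplicative map $f_\bullet : R(X) \to R(Y)$ (norm), all functorial, such that $R$ takes finite disjoint unions to products, transfers and norms satisfy base change along pullback squares, and norms distribute over transfers along exponential diagrams. A Tambara ideal $I$ of $R$ is a family of ideals $I(G/H) \subseteq R(G/H)$, $H \le G$, that is closed under the restrictions, transfers and norms along all equivariant maps between orbits; the product $I \cdot J$ is the Tambara ideal generated by all $ab$ with $a \in I(G/H)$, $b \in J(G/H)$, $H \le G$. A proper Tambara ideal $\mathfrak p$ is prime if $I \cdot J \subseteq \mathfrak p$ implies $I \subseteq \mathfrak p$ or $J \subseteq \mathfrak p$, for all Tambara ideals $I, J$; and $R$ is domain-like if its zero ideal is prime. The group $G$ acts on $R(G/e)$, with $g$ acting by restriction along right multiplication by $g$ on $G/e$; $R$ is clarified if there are no nonzero idempotent $d \in R(G/e)$ and $g \in G$ with $d \cdot gd = 0$. For a subgroup $H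 \le G$ and an $H$-Tambara functor $S$, the coinduction $\mathrm{CoInd}_H^G S$ is the $G$-Tambara functor $X \mapsto S(\mathrm{Res}_H^G X)$. Theorem. Let $G$ be a finite group and $R$ a $G$-Tambara functor. Then $R$ is domain-like if and only if there are a subgroup $H \le G$ and a clarified domain-like $H$-Tambara functor $R_H$ such that $R \cong \mathrm{CoInd}_H^G R_H$ as $G$-Tambara functors. The case $H = G$, in which $R$ itself is clarified, is allowed. -/

import Mathlib

universe u v

/-- A finite `G`-set. -/
structure FinGSet (G : Type u) [Group G] : Type (u + 1) where
  carrier : Type u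
  [action : MulAction G carrier]
  [finite : Finite carrier]

namespace FinGSet

variable {G : Type u} [Group G]

instance : CoeSort (FinGSet G) (Type u) := ⟨FinGSet.carrier⟩

attribute [instance] FinGSet.action FinGSet.finite

/-- The orbit `G / H` of a finite group `G`. -/
def orbit [Finite G] (H : Subgroup G) : FinGSet G := ⟨G ⧸ H⟩

/-- The empty `G`-set. -/
def empty (G : Type u) [Group G] : FinGSet G where
  carrier := PEmpty
  action :=
    { smul := fun _ x => x.elim
      one_smul := fun x => x.elim
      mul_smul := fun _ _ x => x.elim }

/-- Right multiplication by `g`, as a `G`-equivariant self-map of `G / e`. -/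
def rightMul [Finite G] (g : G) :
    (orbit (⊥ : Subgroup G) : FinGSet G) →[G] (orbit (⊥ : Subgroup G) : FinGSet G) where
  toFun := Quotient.map' (fun x : G => x * g) (by
    intro a b h
    rw [QuotientGroup.leftRel_apply, Subgroup.mem_bot, inv_mul_eq_one] at h ⊢
    rw [h])
  map_smul' := by
    intro a x
    induction x using QuotientGroup.induction_on with
    | H z => exact congrArg (QuotientGroup.mk (s := (⊥ : Subgroup G))) (mul_assoc a z g)

/-- The underlying `H`-set of a `G`-set. -/
def restrict (H : Subgroup G) (X : FinGSet G) : FinGSet H := ⟨X.carrier⟩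

/-- A `G`-equivariant map, regarded as an `H`-equivariant map. -/
def restrictMap (H : Subgroup G) {X Y : FinGSet G} (f : X →[G] Y) :
    restrict H X →[H] restrict H Y where
  toFun := f
  map_smul' h x := f.map_smul (h : G) x

/-- The square with sides `a : P → A`, `b : P → B`, `f : A → C`, `g : B → C` is a pullback square
of finite `G`-sets. -/
def IsCartesian {P A B C : FinGSet G} (a : P →[G] A) (b : P →[G] B) (f : A →[G] C)
    (g : B →[G] C) : Prop :=
  (∀ w, f (a w) = g (b w)) ∧ ∀ x y, f x = g y → ∃! w, a w = x ∧ b w = y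

/-- `Z` is the disjoint union of `X` and `Y`, with inclusions `i` and `j`. -/
def IsDisjointUnion {X Y Z : FinGSet G} (i : X →[G] Z) (j : Y →[G] Z) : Prop :=
  Function.Bijective (Sum.elim i j : X ⊕ Y → Z)

/-- The exponential diagram on `p : A → X` and `f : X → Y`:
```
  X <--p-- A <--e-- P
  |                 |
  f                 f'
  v                 v
  Y <------q------- Q
```
The outer square is a pullback, and the points of `Q` over `y : Y` correspond bijectively to the
sections `s` of `p` over the fibre `f ⁻¹ y`; here `z : Q` corresponds to the section that sends `x`
to `e w`, where `w` is the point of `P = X ×_Y Q` that lies over `x` and `z`. So `Q` is the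
dependent product of `A` along `f`, and `e` is the evaluation map. -/
def IsExponential {A X Y P Q : FinGSet G} (p : A →[G] X) (f : X →[G] Y) (e : P →[G] A)
    (f' : P →[G] Q) (q : Q →[G] Y) : Prop :=
  IsCartesian (p.comp e) f' f q ∧
    ∀ (y : Y) (s : {x : X // f x = y} → A), (∀ x, p (s x) = x) →
      ∃! z : Q, q z = y ∧
        ∀ (x : {x : X // f x = y}) (w : P), f' w = z → p (e w) = x → e w = s x

end FinGSet

/-- A `G`-Tambara functor: commutative rings `R(X)` for all finite `G`-sets `X`, with restrictions,
transfers and norms along all equivariant maps, such that `R` takes finite disjoint unions to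
products, transfers and norms satisfy base change along pullback squares, and norms distribute over
transfers as prescribed by exponential diagrams. -/
structure TambaraFunctor (G : Type u) [Group G] where
  obj : FinGSet G → Type v
  [commRing : ∀ X, CommRing (obj X)]
  res : ∀ {X Y : FinGSet G}, (X →[G] Y) → obj Y →+* obj X
  tr : ∀ {X Y : FinGSet G}, (X →[G] Y) → obj X →+ obj Y
  nm : ∀ {X Y : FinGSet G}, (X →[G] Y) → obj X →* obj Y
  res_id : ∀ {X : FinGSet G} (a : obj X), res (MulActionHom.id G) a = a
  tr_id : ∀ {X : FinGSet G} (a : obj X), tr (MulActionHom.id G) a = a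
  nm_id : ∀ {X : FinGSet G} (a : obj X), nm (MulActionHom.id G) a = a
  res_comp : ∀ {X Y Z : FinGSet G} (g : Y →[G] Z) (f : X →[G] Y) (a : obj Z),
    res (g.comp f) a = res f (res g a)
  tr_comp : ∀ {X Y Z : FinGSet G} (g : Y →[G] Z) (f : X →[G] Y) (a : obj X),
    tr (g.comp f) a = tr g (tr f a)
  nm_comp : ∀ {X Y Z : FinGSet G} (g : Y →[G] Z) (f : X →[G] Y) (a : obj X),
    nm (g.comp f) a = nm g (nm f a)
  subsingleton_of_isEmpty : ∀ X : FinGSet G, IsEmpty X → Subsingleton (obj X)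
  bijective_of_isDisjointUnion : ∀ {X Y Z : FinGSet G} (i : X →[G] Z) (j : Y →[G] Z),
    FinGSet.IsDisjointUnion i j → Function.Bijective (fun a : obj Z => (res i a, res j a))
  res_tr : ∀ {P A B C : FinGSet G} (a : P →[G] A) (b : P →[G] B) (f : A →[G] C) (g : B →[G] C),
    FinGSet.IsCartesian a b f g → ∀ t : obj A, res g (tr f t) = tr b (res a t)
  res_nm : ∀ {P A B C : FinGSet G} (a : P →[G] A) (b : P →[G] B) (f : A →[G] C) (g : B →[G] C),
    FinGSet.IsCartesian a b f g → ∀ t : obj A, res g (nm f t) = nm b (res a t)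
  nm_tr : ∀ {A X Y P Q : FinGSet G} (p : A →[G] X) (f : X →[G] Y) (e : P →[G] A)
    (f' : P →[G] Q) (q : Q →[G] Y), FinGSet.IsExponential p f e f' q →
      ∀ t : obj A, nm f (tr p t) = tr q (nm f' (res e t))

namespace TambaraFunctor

variable {G : Type u} [Group G]

attribute [instance] TambaraFunctor.commRing

/-- An isomorphism of `G`-Tambara functors. -/
structure Iso (R S : TambaraFunctor.{u, v} G) where
  equiv : ∀ X : FinGSet G, R.obj X ≃+* S.obj X
  map_res : ∀ {X Y : FinGSet G} (f : X →[G] Y) (a : R.obj Y),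
    equiv X (R.res f a) = S.res f (equiv Y a)
  map_tr : ∀ {X Y : FinGSet G} (f : X →[G] Y) (a : R.obj X),
    equiv Y (R.tr f a) = S.tr f (equiv X a)
  map_nm : ∀ {X Y : FinGSet G} (f : X →[G] Y) (a : R.obj X),
    equiv Y (R.nm f a) = S.nm f (equiv X a)

/-- The coinduced `G`-Tambara functor `CoInd_H^G S`, whose value at a finite `G`-set `X` is the
value of `S` at the underlying `H`-set of `X`. -/
def coind (H : Subgroup G) (S : TambaraFunctor.{u, v} H) : TambaraFunctor.{u, v} G where
  obj X := S.obj (X.restrict H)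
  res f := S.res (FinGSet.restrictMap H f)
  tr f := S.tr (FinGSet.restrictMap H f)
  nm f := S.nm (FinGSet.restrictMap H f)
  res_id := S.res_id
  tr_id := S.tr_id
  nm_id := S.nm_id
  res_comp g f := S.res_comp (FinGSet.restrictMap H g) (FinGSet.restrictMap H f)
  tr_comp g f := S.tr_comp (FinGSet.restrictMap H g) (FinGSet.restrictMap H f)
  nm_comp g f := S.nm_comp (FinGSet.restrictMap H g) (FinGSet.restrictMap H f)
  subsingleton_of_isEmpty X h := S.subsingleton_of_isEmpty (X.restrict H) h
  bijective_of_isDisjointUnion i j h :=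
    S.bijective_of_isDisjointUnion (FinGSet.restrictMap H i) (FinGSet.restrictMap H j) h
  res_tr _ _ _ _ h := S.res_tr _ _ _ _ h
  res_nm _ _ _ _ h := S.res_nm _ _ _ _ h
  nm_tr _ _ _ _ _ h := S.nm_tr _ _ _ _ _ h

section Ideals

variable [Finite G]

/-- A Tambara ideal: ideals `I(G/H)` of `R(G/H)` for all subgroups `H`, closed under restriction,
transfer and norm along all equivariant maps between orbits. These maps are exactly the composites
of the projections `G/K → G/H` for `K ≤ H` and the conjugation isomorphisms. -/
@[ext]
structure TambaraIdeal (R : TambaraFunctor.{u, v} G) where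
  ideal : ∀ H : Subgroup G, Ideal (R.obj (FinGSet.orbit H))
  res_mem : ∀ {K H : Subgroup G} (f : FinGSet.orbit K →[G] FinGSet.orbit H)
    {a : R.obj (FinGSet.orbit H)}, a ∈ ideal H → R.res f a ∈ ideal K
  tr_mem : ∀ {K H : Subgroup G} (f : FinGSet.orbit K →[G] FinGSet.orbit H)
    {a : R.obj (FinGSet.orbit K)}, a ∈ ideal K → R.tr f a ∈ ideal H
  nm_mem : ∀ {K H : Subgroup G} (f : FinGSet.orbit K →[G] FinGSet.orbit H)
    {a : R.obj (FinGSet.orbit K)}, a ∈ ideal K → R.nm f a ∈ ideal H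

/-- Norms along maps of orbits preserve zero. -/
theorem nm_orbit_zero (R : TambaraFunctor.{u, v} G) {K H : Subgroup G}
    (f : FinGSet.orbit K →[G] FinGSet.orbit H) : R.nm f 0 = 0 := by
  let E : FinGSet G := FinGSet.empty G
  have hE : Subsingleton (R.obj E) := R.subsingleton_of_isEmpty E (inferInstanceAs (IsEmpty PEmpty))
  let p : ∀ X : FinGSet G, E →[G] X := fun X =>
    { toFun := fun x => PEmpty.elim x, map_smul' := fun _ x => PEmpty.elim x }
  have hf : Function.Surjective f := by
    intro y
    have : MulAction.IsPretransitive G (FinGSet.orbit H) :=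
      inferInstanceAs (MulAction.IsPretransitive G (G ⧸ H))
    let x : FinGSet.orbit K := ((1 : G) : G ⧸ K)
    obtain ⟨g, hg⟩ := MulAction.exists_smul_eq G (f x) y
    exact ⟨g • x, by rw [map_smul, hg]⟩
  have h : FinGSet.IsExponential (p (FinGSet.orbit K)) f (p E) (p E) (p (FinGSet.orbit H)) := by
    refine ⟨⟨fun w => PEmpty.elim w, fun _ y => PEmpty.elim y⟩, fun y s _ => ?_⟩
    obtain ⟨x, hx⟩ := hf y
    exact PEmpty.elim (s ⟨x, hx⟩)
  have h1 := R.nm_tr _ _ _ _ _ h 0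
  rw [map_zero] at h1
  rw [h1, Subsingleton.elim (R.nm (p E) (R.res (p E) 0)) 0, map_zero]

namespace TambaraIdeal

variable {R : TambaraFunctor.{u, v} G}

/-- Inclusion of Tambara ideals. -/
instance : LE (TambaraIdeal R) := ⟨fun I J => ∀ H, I.ideal H ≤ J.ideal H⟩

/-- The zero ideal. -/
instance : Bot (TambaraIdeal R) where
  bot :=
    { ideal := fun _ => ⊥
      res_mem := by
        intro K H f a ha
        rw [Ideal.mem_bot] at ha ⊢
        rw [ha, map_zero]
      tr_mem := by
        intro K H f a ha
        rw [Ideal.mem_bot] at ha ⊢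
        rw [ha, map_zero]
      nm_mem := by
        intro K H f a ha
        rw [Ideal.mem_bot] at ha ⊢
        rw [ha, nm_orbit_zero] }

/-- The Tambara ideal generated by a set of elements in each level: the intersection of all
Tambara ideals that contain these elements. -/
def span (s : ∀ H : Subgroup G, Set (R.obj (FinGSet.orbit H))) : TambaraIdeal R where
  ideal H := ⨅ (I : TambaraIdeal R) (_ : ∀ L, s L ⊆ I.ideal L), I.ideal H
  res_mem := by
    intro K H f a ha
    simp only [Submodule.mem_iInf] at ha ⊢
    exact fun I hI => I.res_mem f (ha I hI)
  tr_mem := by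
    intro K H f a ha
    simp only [Submodule.mem_iInf] at ha ⊢
    exact fun I hI => I.tr_mem f (ha I hI)
  nm_mem := by
    intro K H f a ha
    simp only [Submodule.mem_iInf] at ha ⊢
    exact fun I hI => I.nm_mem f (ha I hI)

/-- The product of Tambara ideals: the Tambara ideal generated by the levelwise products. -/
instance : Mul (TambaraIdeal R) :=
  ⟨fun I J => span fun H => {x | ∃ a ∈ I.ideal H, ∃ b ∈ J.ideal H, x = a * b}⟩

/-- A proper Tambara ideal `P` is prime if `I * J ≤ P` implies `I ≤ P` or `J ≤ P`. -/
def IsPrime (P : TambaraIdeal R) : Prop :=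
  (∃ H, P.ideal H ≠ ⊤) ∧ ∀ I J : TambaraIdeal R, I * J ≤ P → I ≤ P ∨ J ≤ P

end TambaraIdeal

/-- `R` is domain-like if its zero ideal is prime. -/
def IsDomainLike (R : TambaraFunctor.{u, v} G) : Prop :=
  (⊥ : TambaraIdeal R).IsPrime

/-- The action of `g : G` on `R(G/e)`: restriction along right multiplication by `g`. -/
def conjAct (R : TambaraFunctor.{u, v} G) (g : G) :
    R.obj (FinGSet.orbit (⊥ : Subgroup G)) →+* R.obj (FinGSet.orbit (⊥ : Subgroup G)) :=
  R.res (FinGSet.rightMul g)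

/-- `R` is clarified if there is no nonzero idempotent `d` in `R(G/e)` with `d * g d = 0` for
some `g : G`. -/
def IsClarified (R : TambaraFunctor.{u, v} G) : Prop :=
  ¬ ∃ d : R.obj (FinGSet.orbit (⊥ : Subgroup G)),
    d ≠ 0 ∧ IsIdempotentElem d ∧ ∃ g : G, d * R.conjAct g d = 0

end Ideals

end TambaraFunctor

/-! The subgroup `H` is found from idempotents of `A = R(G/e)`. If `R` is domain-like then `A` is
nonzero. Among the nonzero idempotents of `A`, take one whose set of orthogonalizing group elements
is maximal. The complement of this set is a subgroup `H`, and the product `d` of the `H`-translates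
is a nonzero `H`-invariant idempotent, orthogonal to its translates by elements outside `H`. By
maximality, no nonzero idempotent below `d` is orthogonal to an `H`-translate of itself
(`exists_idempotent_with_orthogonal_translates`).

Let `e` be the norm of `d` to `R(G/H)` and `t` the transfer of `e` to `R(G/G)`. The restriction of
`e` to `G/e` is `d` again, and restrictions of `e` along pointwise distinct maps are orthogonal, so
`t` is idempotent. Its restriction to `G/e` is a `G`-invariant idempotent above `d`. An invariant
idempotent generates a Tambara ideal whose product with its annihilator is zero, so domain-likeness
forces this restriction to be `1` (`d_eq_one_of_isDomainLike`). Taking the norm of this equation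
back to `G/G` and expanding it by the exponential formula gives `t = 1` (`t_eq_one`).

Now `S(X) = e R(G ×_H X)` is an `H`-Tambara functor, its norms being cut down by `e`. For a `G`-set
`X`, restriction along `G ×_H X → X` followed by multiplication with `e` is inverse to transfer,
because `t = 1`; this is the isomorphism `R ≅ CoInd S`. The ring `S(H/e)` is identified with `dA`,
so the choice of `d` makes `S` clarified.

Domain-likeness passes in both directions through any isomorphism `R ≅ CoInd S`: Tambara ideals can
be carried either way so that zero products are preserved and only the zero ideal goes to zero. This
also gives the converse. -/

namespace FinGSet

open scoped Pointwise

variable {G : Type u} [Group G]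

/-! ### Constructions of finite `G`-sets -/

/-- The pullback of finite `G`-sets. -/
def pullback {A B C : FinGSet G} (f : A →[G] C) (g : B →[G] C) : FinGSet G where
  carrier := {p : A × B // f p.1 = g p.2}
  action :=
    { smul := fun a p => ⟨a • p.1, by
        rw [Prod.smul_fst, Prod.smul_snd, map_smul, map_smul, p.2]⟩
      one_smul := fun p => Subtype.ext (one_smul G p.1)
      mul_smul := fun a b p => Subtype.ext (mul_smul a b p.1) }

/-- The first projection of a pullback. -/
def pullbackFst {A B C : FinGSet G} (f : A →[G] C) (g : B →[G] C) : pullback f g →[G] A where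
  toFun p := p.1.1
  map_smul' _ _ := rfl

/-- The second projection of a pullback. -/
def pullbackSnd {A B C : FinGSet G} (f : A →[G] C) (g : B →[G] C) : pullback f g →[G] B where
  toFun p := p.1.2
  map_smul' _ _ := rfl

theorem isCartesian_pullback {A B C : FinGSet G} (f : A →[G] C) (g : B →[G] C) :
    IsCartesian (pullbackFst f g) (pullbackSnd f g) f g := by
  refine ⟨fun w => w.2, fun x y h => ⟨⟨(x, y), h⟩, ⟨rfl, rfl⟩, ?_⟩⟩
  rintro ⟨⟨x', y'⟩, h'⟩ ⟨rfl, rfl⟩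
  rfl

/-- The lift of a commutative square to the pullback. -/
def pullbackLift {T A B C : FinGSet G} (f : A →[G] C) (g : B →[G] C) (a : T →[G] A) (b : T →[G] B)
    (h : ∀ t, f (a t) = g (b t)) : T →[G] pullback f g where
  toFun t := ⟨(a t, b t), h t⟩
  map_smul' c t := Subtype.ext (Prod.ext (map_smul a c t) (map_smul b c t))

theorem isCartesian_of_bijective {A B : FinGSet G} (f : A →[G] B) (hf : Function.Bijective f) :
    IsCartesian f f (MulActionHom.id G) (MulActionHom.id G) := by
  refine ⟨fun w => rfl, fun x y h => ?_⟩
  obtain ⟨w, rfl⟩ := hf.2 x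
  exact ⟨w, ⟨rfl, h⟩, fun w' hw => hf.1 hw.1⟩

theorem isCartesian_of_injective {A B : FinGSet G} (f : A →[G] B) (hf : Function.Injective f) :
    IsCartesian (MulActionHom.id G) (MulActionHom.id G) f f := by
  refine ⟨fun w => rfl, fun x y h => ⟨x, ⟨rfl, hf h⟩, fun w hw => hw.1⟩⟩

/-- The disjoint union of finite `G`-sets. -/
def sum (X Y : FinGSet G) : FinGSet G where
  carrier := X ⊕ Y
  action :=
    { smul := fun g => Sum.map (g • ·) (g • ·)
      one_smul := by
        rintro (x | x)
        · exact congrArg Sum.inl (one_smul G x)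
        · exact congrArg Sum.inr (one_smul G x)
      mul_smul := by
        rintro a b (x | x)
        · exact congrArg Sum.inl (mul_smul a b x)
        · exact congrArg Sum.inr (mul_smul a b x) }

/-- The left inclusion into a disjoint union. -/
def inl (X Y : FinGSet G) : X →[G] sum X Y where
  toFun := Sum.inl
  map_smul' _ _ := rfl

/-- The right inclusion into a disjoint union. -/
def inr (X Y : FinGSet G) : Y →[G] sum X Y where
  toFun := Sum.inr
  map_smul' _ _ := rfl

/-- The map out of a disjoint union given by two maps. -/
def sumElim {X Y Z : FinGSet G} (f : X →[G] Z) (g : Y →[G] Z) : sum X Y →[G] Z where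
  toFun := Sum.elim f g
  map_smul' := by
    rintro a (x | x)
    · exact map_smul f a x
    · exact map_smul g a x

/-- The disjoint union of two maps. -/
def sumMap {X Y X' Y' : FinGSet G} (f : X →[G] X') (g : Y →[G] Y') : sum X Y →[G] sum X' Y' :=
  sumElim ((inl X' Y').comp f) ((inr X' Y').comp g)

theorem isDisjointUnion_sum (X Y : FinGSet G) : IsDisjointUnion (inl X Y) (inr X Y) := by
  have : (Sum.elim (inl X Y) (inr X Y) : X ⊕ Y → sum X Y) = id := by
    funext x; cases x <;> rfl
  unfold IsDisjointUnion
  rw [this]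
  exact Function.bijective_id

theorem isDisjointUnion_iff {X Y Z : FinGSet G} (i : X →[G] Z) (j : Y →[G] Z) :
    IsDisjointUnion i j ↔ Function.Injective i ∧ Function.Injective j ∧ (∀ x y, i x ≠ j y) ∧
      ∀ z, (∃ x, i x = z) ∨ ∃ y, j y = z := by
  unfold IsDisjointUnion
  constructor
  · intro h
    refine ⟨fun x y e => ?_, fun x y e => ?_, fun x y e => ?_, fun z => ?_⟩
    · simpa using @h.1 (Sum.inl x) (Sum.inl y) e
    · simpa using @h.1 (Sum.inr x) (Sum.inr y) e
    · simpa using @h.1 (Sum.inl x) (Sum.inr y) e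
    · obtain ⟨x | y, e⟩ := h.2 z
      · exact Or.inl ⟨x, e⟩
      · exact Or.inr ⟨y, e⟩
  · rintro ⟨h1, h2, h3, h4⟩
    refine ⟨h1.sumElim h2 h3, fun z => ?_⟩
    obtain ⟨x, e⟩ | ⟨y, e⟩ := h4 z
    · exact ⟨Sum.inl x, e⟩
    · exact ⟨Sum.inr y, e⟩

/-- The `G`-set of points outside of the image of a map. -/
def compl {X Z : FinGSet G} (i : X →[G] Z) : FinGSet G where
  carrier := {z : Z // ∀ x, i x ≠ z}
  action :=
    { smul := fun g z => ⟨g • z.1, fun x hx => z.2 (g⁻¹ • x) (by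
        rw [map_smul, hx, inv_smul_smul])⟩
      one_smul := fun z => Subtype.ext (one_smul G z.1)
      mul_smul := fun a b z => Subtype.ext (mul_smul a b z.1) }

/-- The inclusion of the complement of the image of a map. -/
def complIncl {X Z : FinGSet G} (i : X →[G] Z) : compl i →[G] Z where
  toFun z := z.1
  map_smul' _ _ := rfl

theorem isDisjointUnion_compl {X Z : FinGSet G} (i : X →[G] Z) (hi : Function.Injective i) :
    IsDisjointUnion i (complIncl i) := by
  rw [isDisjointUnion_iff]
  refine ⟨hi, Subtype.val_injective, fun x y => y.2 x, fun z => ?_⟩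
  by_cases h : ∃ x, i x = z
  · exact Or.inl h
  · exact Or.inr ⟨⟨z, not_exists.mp h⟩, rfl⟩

/-- The unique map out of the empty `G`-set. -/
def emptyMap (X : FinGSet G) : empty G →[G] X where
  toFun x := PEmpty.elim x
  map_smul' _ x := PEmpty.elim x

instance : IsEmpty (empty G) := inferInstanceAs (IsEmpty PEmpty)

theorem isCartesian_empty {X Y Z : FinGSet G} (i : X →[G] Z) (j : Y →[G] Z)
    (h : ∀ x y, i x ≠ j y) : IsCartesian (emptyMap X) (emptyMap Y) i j :=
  ⟨fun w => PEmpty.elim w, fun x y e => (h x y e).elim⟩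

/-! ### Dependent products -/

/-- The dependent product of `p : A → X` along `f : X → Y`. Sections of `p` over a fibre of `f` are
encoded as subsets of `A`. -/
def depProd {A X Y : FinGSet G} (p : A →[G] X) (f : X →[G] Y) : FinGSet G where
  carrier := {z : Y × Set A // (∀ a ∈ z.2, f (p a) = z.1) ∧
    ∀ x, f x = z.1 → ∃! a, a ∈ z.2 ∧ p a = x}
  action :=
    { smul := fun g z => ⟨g • z.1, by
        constructor
        · rintro _ ⟨a, ha, rfl⟩
          change f (p (g • a)) = g • z.1.1
          rw [map_smul, map_smul, z.2.1 a ha]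
        · intro x hx
          have hx' : f (g⁻¹ • x) = z.1.1 := by
            rw [map_smul, hx]
            exact inv_smul_smul g z.1.1
          obtain ⟨a, ⟨ha, hax⟩, hu⟩ := z.2.2 _ hx'
          refine ⟨g • a, ⟨Set.smul_mem_smul_set ha, by rw [map_smul, hax, smul_inv_smul]⟩, ?_⟩
          rintro _ ⟨⟨b, hb, rfl⟩, hbx⟩
          exact congrArg (g • ·) (hu b ⟨hb, by rw [← hbx, map_smul, inv_smul_smul]⟩)⟩
      one_smul := fun z => Subtype.ext (one_smul G z.1)
      mul_smul := fun a b z => Subtype.ext (mul_smul a b z.1) }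

/-- The projection of a dependent product to its base. -/
def depProdBase {A X Y : FinGSet G} (p : A →[G] X) (f : X →[G] Y) : depProd p f →[G] Y where
  toFun z := z.1.1
  map_smul' _ _ := rfl

/-- The domain of the evaluation map of a dependent product. -/
def depProdEval {A X Y : FinGSet G} (p : A →[G] X) (f : X →[G] Y) : FinGSet G where
  carrier := {w : A × depProd p f // w.1 ∈ w.2.1.2}
  action :=
    { smul := fun g w => ⟨g • w.1, Set.smul_mem_smul_set w.2⟩
      one_smul := fun z => Subtype.ext (one_smul G z.1)
      mul_smul := fun a b z => Subtype.ext (mul_smul a b z.1) }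

/-- The evaluation map of a dependent product. -/
def depProdEvalFst {A X Y : FinGSet G} (p : A →[G] X) (f : X →[G] Y) : depProdEval p f →[G] A where
  toFun w := w.1.1
  map_smul' _ _ := rfl

/-- The projection of the domain of the evaluation map to the dependent product. -/
def depProdEvalSnd {A X Y : FinGSet G} (p : A →[G] X) (f : X →[G] Y) :
    depProdEval p f →[G] depProd p f where
  toFun w := w.1.2
  map_smul' _ _ := rfl

/-- A section over a fibre is determined by its range, and `G` acts on ranges by translation.
Encoding sections as subsets makes finiteness automatic and avoids functions on varying fibres. -/
theorem isExponential_depProd {A X Y : FinGSet G} (p : A →[G] X) (f : X →[G] Y) :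
    IsExponential p f (depProdEvalFst p f) (depProdEvalSnd p f) (depProdBase p f) := by
  refine ⟨⟨fun w => w.1.2.2.1 _ w.2, fun x z h => ?_⟩, fun y s hs => ?_⟩
  · obtain ⟨a, ⟨ha, hax⟩, hu⟩ := z.2.2 x h
    refine ⟨⟨(a, z), ha⟩, ⟨hax, rfl⟩, ?_⟩
    rintro ⟨⟨b, z'⟩, hb⟩ ⟨h1, h2⟩
    obtain rfl : z' = z := h2
    exact Subtype.ext (Prod.ext (hu b ⟨hb, h1⟩) rfl)
  · have hT : (∀ a ∈ Set.range s, f (p a) = y) ∧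
        ∀ x, f x = y → ∃! a, a ∈ Set.range s ∧ p a = x := by
      refine ⟨?_, fun x hx => ⟨s ⟨x, hx⟩, ⟨⟨_, rfl⟩, hs _⟩, ?_⟩⟩
      · rintro _ ⟨x, rfl⟩
        rw [hs]
        exact x.2
      · rintro _ ⟨⟨x', rfl⟩, h⟩
        rw [hs] at h
        subst h
        rfl
    refine ⟨⟨(y, Set.range s), hT⟩, ⟨rfl, ?_⟩, ?_⟩
    · rintro x ⟨⟨a, z⟩, ha⟩ hz hx
      obtain rfl : z = _ := hz
      obtain ⟨x', hx'⟩ : a ∈ Set.range s := ha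
      change a = s x
      change p a = x at hx
      rw [← hx', hs] at hx
      rw [← hx', Subtype.ext hx]
    · rintro ⟨⟨y', T⟩, hz⟩ ⟨hy, hT'⟩
      obtain rfl : y' = y := hy
      refine Subtype.ext (Prod.ext rfl ?_)
      change T = Set.range s
      ext a
      constructor
      · intro ha
        exact ⟨⟨p a, hz.1 a ha⟩, (hT' ⟨p a, hz.1 a ha⟩ ⟨(a, ⟨(y', T), hz⟩), ha⟩ rfl rfl).symm⟩
      · rintro ⟨x, rfl⟩
        obtain ⟨a, ⟨ha, hax⟩, -⟩ := hz.2 x.1 x.2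
        have : a = s x := hT' x ⟨(a, ⟨(y', T), hz⟩), ha⟩ rfl hax
        rw [← this]
        exact ha

/-- The exponential diagram that expresses Frobenius reciprocity. -/
theorem isExponential_fold {A X : FinGSet G} (f : A →[G] X) :
    IsExponential (sumMap f (MulActionHom.id G)) (sumElim (MulActionHom.id G) (MulActionHom.id G))
      (sumMap (MulActionHom.id G) f) (sumElim (MulActionHom.id G) (MulActionHom.id G)) f := by
  refine ⟨⟨?_, ?_⟩, ?_⟩
  · rintro (a | a) <;> rfl
  · rintro (x | x) a h
    · obtain rfl : x = f a := h
      refine ⟨Sum.inl a, ⟨rfl, rfl⟩, ?_⟩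
      rintro (b | b) ⟨h1, h2⟩
      · exact congrArg Sum.inl h2
      · cases h1
    · obtain rfl : x = f a := h
      refine ⟨Sum.inr a, ⟨rfl, rfl⟩, ?_⟩
      rintro (b | b) ⟨h1, h2⟩
      · cases h1
      · exact congrArg Sum.inr h2
  · intro x s hs
    have h1 := hs ⟨Sum.inl x, rfl⟩
    have h2 := hs ⟨Sum.inr x, rfl⟩
    -- The fibre over `x` is `{inl x, inr x}`. The value of a section at `inr x` is forced, and its
    -- value at `inl x` is a point of `A` over `x`; hence the dependent product is `A` itself.
    rcases e1 : s ⟨Sum.inl x, rfl⟩ with a | a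
    · rcases e2 : s ⟨Sum.inr x, rfl⟩ with b | b
      · rw [e2] at h2; cases h2
      · rw [e1] at h1
        rw [e2] at h2
        have ha : f a = x := Sum.inl.inj h1
        have hb : b = x := Sum.inr.inj h2
        refine ⟨a, ⟨ha, ?_⟩, ?_⟩
        · rintro ⟨y, hy⟩ (w | w) hw hwy
          · obtain rfl : w = a := hw
            obtain rfl : Sum.inl (f w) = y := hwy
            subst ha
            exact e1.symm
          · obtain rfl : w = a := hw
            obtain rfl : Sum.inr (f w) = y := hwy
            subst ha hb
            exact e2.symm
        · rintro a' ⟨ha', h'⟩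
          have := h' ⟨Sum.inl x, rfl⟩ (Sum.inl a') rfl (congrArg Sum.inl ha')
          rw [e1] at this
          exact Sum.inl.inj this
    · rw [e1] at h1; cases h1

/-! ### Orbits -/

section Orbits

variable [Finite G]

/-- The map out of an orbit given by a point with sufficiently large stabilizer. -/
def orbitTo (K : Subgroup G) {X : FinGSet G} (x : X) (h : K ≤ MulAction.stabilizer G x) :
    orbit K →[G] X where
  toFun := Quotient.lift (fun g : G => g • x) (by
    intro a b hab
    rw [← Quotient.eq_iff_equiv, Quotient.eq, QuotientGroup.leftRel_apply] at hab
    have : (a⁻¹ * b) • x = x := h hab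
    change a • x = b • x
    rw [← this, ← mul_smul, mul_inv_cancel_left, this])
  map_smul' := by
    intro a y
    induction y using QuotientGroup.induction_on with
    | H z => exact mul_smul a z x

/-- The base point of an orbit. -/
def pt (K : Subgroup G) : orbit K := ((1 : G) : G ⧸ K)

@[simp]
theorem orbitTo_pt (K : Subgroup G) {X : FinGSet G} (x : X) (h : K ≤ MulAction.stabilizer G x) :
    orbitTo K x h (pt K) = x := one_smul G x

theorem exists_smul_eq_orbit {K : Subgroup G} (x y : orbit K) : ∃ g : G, g • x = y :=
  have : MulAction.IsPretransitive G (orbit K) :=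
    inferInstanceAs (MulAction.IsPretransitive G (G ⧸ K))
  MulAction.exists_smul_eq G x y

theorem orbit_hom_ext {K : Subgroup G} {X : FinGSet G} {f g : orbit K →[G] X} (x : orbit K)
    (h : f x = g x) : f = g := by
  ext y
  obtain ⟨a, rfl⟩ := exists_smul_eq_orbit x y
  rw [map_smul, map_smul, h]

/-- The map out of the free orbit given by a point. -/
def free {X : FinGSet G} (x : X) : orbit (⊥ : Subgroup G) →[G] X := orbitTo ⊥ x bot_le

@[simp]
theorem free_pt {X : FinGSet G} (x : X) : free x (pt ⊥) = x := orbitTo_pt _ _ _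

theorem comp_free {X Y : FinGSet G} (f : X →[G] Y) (x : X) : f.comp (free x) = free (f x) :=
  orbit_hom_ext (pt ⊥) (by
    rw [free_pt]
    exact congrArg f (free_pt x))

theorem eq_free {X : FinGSet G} (f : orbit (⊥ : Subgroup G) →[G] X) : f = free (f (pt ⊥)) :=
  orbit_hom_ext (pt ⊥) (free_pt _).symm

theorem smul_pt_bot_inj {a b : G} (h : a • pt (⊥ : Subgroup G) = b • pt (⊥ : Subgroup G)) :
    a = b := by
  have h' : ((a * 1 : G) : G ⧸ (⊥ : Subgroup G)) = ((b * 1 : G) : G ⧸ (⊥ : Subgroup G)) := h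
  rw [QuotientGroup.eq, Subgroup.mem_bot, inv_mul_eq_one] at h'
  simpa using h'

theorem rightMul_eq_free (g : G) : rightMul g = free (g • pt (⊥ : Subgroup G)) :=
  orbit_hom_ext (pt ⊥) (by
    rw [free_pt]
    change ((1 * g : G) : G ⧸ (⊥ : Subgroup G)) = ((g * 1 : G) : G ⧸ (⊥ : Subgroup G))
    simp)

theorem smul_pt_eq_iff {K : Subgroup G} (a b : G) : a • pt K = b • pt K ↔ a⁻¹ * b ∈ K := by
  change ((a * 1 : G) : G ⧸ K) = ((b * 1 : G) : G ⧸ K) ↔ _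
  rw [QuotientGroup.eq]
  simp

theorem orbit_hom_surjective {X : FinGSet G} {K : Subgroup G} [Nonempty X] (f : X →[G] orbit K) :
    Function.Surjective f := by
  intro y
  obtain ⟨x⟩ := ‹Nonempty X›
  obtain ⟨g, hg⟩ := exists_smul_eq_orbit (f x) y
  exact ⟨g • x, by rw [map_smul, hg]⟩

instance (K : Subgroup G) : Nonempty (orbit K) := ⟨pt K⟩

/-- The inclusion of the orbit of a point. -/
def orbitIncl {X : FinGSet G} (x : X) : orbit (MulAction.stabilizer G x) →[G] X :=
  orbitTo _ x le_rfl

theorem orbitIncl_injective {X : FinGSet G} (x : X) : Function.Injective (orbitIncl x) := by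
  intro y z h
  obtain ⟨a, rfl⟩ := exists_smul_eq_orbit (pt _) y
  obtain ⟨b, rfl⟩ := exists_smul_eq_orbit (pt _) z
  rw [map_smul, map_smul, orbitIncl, orbitTo_pt] at h
  rw [smul_pt_eq_iff, MulAction.mem_stabilizer_iff, mul_smul, ← h, inv_smul_smul]

theorem orbitIncl_pt {X : FinGSet G} (x : X) : orbitIncl x (pt _) = x := orbitTo_pt _ _ _

/-- Finite `G`-sets are built from the empty set by adding orbits. -/
theorem orbit_induction {C : FinGSet G → Prop} (h0 : ∀ X : FinGSet G, IsEmpty X → C X)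
    (h1 : ∀ (K : Subgroup G) (Y Z : FinGSet G) (i : orbit K →[G] Z) (j : Y →[G] Z),
      IsDisjointUnion i j → C Y → C Z) (X : FinGSet G) : C X := by
  induction hn : Nat.card X using Nat.strong_induction_on generalizing X with
  | _ n ih =>
    rcases isEmpty_or_nonempty X with hX | ⟨⟨x⟩⟩
    · exact h0 X hX
    · refine h1 _ _ _ (orbitIncl x) _ (isDisjointUnion_compl _ (orbitIncl_injective x))
        (ih _ ?_ _ rfl)
      rw [← hn]
      refine Finite.card_subtype_lt (x := x) ?_
      simpa using ⟨_, orbitIncl_pt x⟩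

end Orbits

end FinGSet

namespace TambaraFunctor

open FinGSet

variable {G : Type u} [Group G] (R : TambaraFunctor.{u, v} G)

/-! ### Formal consequences of the axioms -/

theorem res_nm_of_injective {X Y : FinGSet G} (f : X →[G] Y) (hf : Function.Injective f)
    (x : R.obj X) : R.res f (R.nm f x) = x := by
  rw [R.res_nm _ _ _ _ (isCartesian_of_injective f hf), R.res_id, R.nm_id]

theorem res_tr_of_injective {X Y : FinGSet G} (f : X →[G] Y) (hf : Function.Injective f)
    (x : R.obj X) : R.res f (R.tr f x) = x := by
  rw [R.res_tr _ _ _ _ (isCartesian_of_injective f hf), R.res_id, R.tr_id]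

theorem nm_res_of_bijective {X Y : FinGSet G} (f : X →[G] Y) (hf : Function.Bijective f)
    (y : R.obj Y) : R.nm f (R.res f y) = y := by
  rw [← R.res_nm _ _ _ _ (isCartesian_of_bijective f hf), R.res_id, R.nm_id]

theorem res_injective_of_bijective {X Y : FinGSet G} (f : X →[G] Y) (hf : Function.Bijective f) :
    Function.Injective (R.res f) := by
  intro a b h
  rw [← R.nm_res_of_bijective f hf a, h, R.nm_res_of_bijective f hf]

theorem res_tr_of_disjoint {X Y Z : FinGSet G} (i : X →[G] Z) (j : Y →[G] Z)
    (h : ∀ x y, i x ≠ j y) (x : R.obj X) : R.res j (R.tr i x) = 0 := by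
  have := R.subsingleton_of_isEmpty (empty G) inferInstance
  rw [R.res_tr _ _ _ _ (isCartesian_empty i j h), Subsingleton.elim (R.res (emptyMap X) x) 0,
    map_zero]

theorem res_nm_of_disjoint {X Y Z : FinGSet G} (i : X →[G] Z) (j : Y →[G] Z)
    (h : ∀ x y, i x ≠ j y) (x : R.obj X) : R.res j (R.nm i x) = 1 := by
  have := R.subsingleton_of_isEmpty (empty G) inferInstance
  rw [R.res_nm _ _ _ _ (isCartesian_empty i j h), Subsingleton.elim (R.res (emptyMap X) x) 1,
    map_one]

variable {R} in
theorem ext_of_isDisjointUnion {X Y Z : FinGSet G} {i : X →[G] Z} {j : Y →[G] Z}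
    (h : IsDisjointUnion i j) {a b : R.obj Z} (hi : R.res i a = R.res i b)
    (hj : R.res j a = R.res j b) : a = b :=
  (R.bijective_of_isDisjointUnion i j h).1 (Prod.ext hi hj)

variable {R} in
-- The norm along a summand inclusion extends an element by `1`, so `z` is the product of the
-- extensions of its two components.
theorem nm_eq_mul {X Y Z W : FinGSet G} {i : X →[G] Z} {j : Y →[G] Z}
    (h : IsDisjointUnion i j) (f : Z →[G] W) (z : R.obj Z) :
    R.nm f z = R.nm (f.comp i) (R.res i z) * R.nm (f.comp j) (R.res j z) := by
  obtain ⟨h1, h2, h3, -⟩ := (isDisjointUnion_iff i j).mp h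
  rw [R.nm_comp, R.nm_comp, ← map_mul]
  congr 1
  refine ext_of_isDisjointUnion h ?_ ?_
  · rw [map_mul, R.res_nm_of_injective i h1, R.res_nm_of_disjoint j i fun x y => (h3 y x).symm,
      mul_one]
  · rw [map_mul, R.res_nm_of_injective j h2, R.res_nm_of_disjoint i j h3, one_mul]

variable {R} in
-- The transfer along a summand inclusion extends an element by `0`, so `z` is the sum of the
-- extensions of its two components.
theorem tr_eq_add {X Y Z W : FinGSet G} {i : X →[G] Z} {j : Y →[G] Z}
    (h : IsDisjointUnion i j) (f : Z →[G] W) (z : R.obj Z) :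
    R.tr f z = R.tr (f.comp i) (R.res i z) + R.tr (f.comp j) (R.res j z) := by
  obtain ⟨h1, h2, h3, -⟩ := (isDisjointUnion_iff i j).mp h
  rw [R.tr_comp, R.tr_comp, ← map_add]
  congr 1
  refine ext_of_isDisjointUnion h ?_ ?_
  · rw [map_add, R.res_tr_of_injective i h1, R.res_tr_of_disjoint j i fun x y => (h3 y x).symm,
      add_zero]
  · rw [map_add, R.res_tr_of_injective j h2, R.res_tr_of_disjoint i j h3, zero_add]

theorem nm_sumElim_id {X : FinGSet G} (z : R.obj (FinGSet.sum X X)) :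
    R.nm (sumElim (MulActionHom.id G) (MulActionHom.id G)) z =
      R.res (inl X X) z * R.res (inr X X) z := by
  rw [nm_eq_mul (isDisjointUnion_sum X X)]
  exact congrArg₂ (· * ·) (R.nm_id _) (R.nm_id _)

theorem isCartesian_inl_sumMap {X Y X' Y' : FinGSet G} (f : X →[G] X') (g : Y →[G] Y') :
    IsCartesian (inl X Y) f (sumMap f g) (inl X' Y') := by
  refine ⟨fun _ => rfl, ?_⟩
  rintro (x | y) x' h
  · exact ⟨x, ⟨rfl, Sum.inl.inj h⟩, fun w hw => Sum.inl.inj hw.1⟩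
  · cases h

theorem isCartesian_inr_sumMap {X Y X' Y' : FinGSet G} (f : X →[G] X') (g : Y →[G] Y') :
    IsCartesian (inr X Y) g (sumMap f g) (inr X' Y') := by
  refine ⟨fun _ => rfl, ?_⟩
  rintro (x | y) x' h
  · cases h
  · exact ⟨y, ⟨rfl, Sum.inr.inj h⟩, fun w hw => Sum.inr.inj hw.1⟩

/-- Frobenius reciprocity. -/
theorem tr_mul {A X : FinGSet G} (f : A →[G] X) (a : R.obj A) (x : R.obj X) :
    R.tr f a * x = R.tr f (a * R.res f x) := by
  -- The norm along a fold map multiplies components. The formula is the exponential formula for the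
  -- element of `R(A ⊔ X)` with components `a` and `x`.
  obtain ⟨z, hz⟩ := (R.bijective_of_isDisjointUnion _ _ (isDisjointUnion_sum A X)).2 (a, x)
  obtain ⟨h1, h2⟩ := Prod.ext_iff.mp hz
  dsimp only at h1 h2
  have h := R.nm_tr _ _ _ _ _ (isExponential_fold f) z
  rw [nm_sumElim_id, nm_sumElim_id, R.res_tr _ _ _ _ (isCartesian_inl_sumMap f _),
    R.res_tr _ _ _ _ (isCartesian_inr_sumMap f _), h1, h2, R.tr_id, ← R.res_comp,
    ← R.res_comp] at h
  rw [h, ← h1, ← h2, ← R.res_comp]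
  rfl

theorem mul_tr {A X : FinGSet G} (f : A →[G] X) (a : R.obj A) (x : R.obj X) :
    x * R.tr f a = R.tr f (R.res f x * a) := by
  rw [mul_comm, tr_mul, mul_comm]

theorem nm_dvd_nm {X Z W : FinGSet G} (i : X →[G] Z) (hi : Function.Injective i) (f : Z →[G] W)
    (z : R.obj Z) : R.nm (f.comp i) (R.res i z) ∣ R.nm f z := by
  rw [nm_eq_mul (isDisjointUnion_compl i hi)]
  exact dvd_mul_right _ _

/-- `T` embeds in the pullback, and the norm from the pullback is a product over `T` and its
complement. This isolates one factor of the double coset formula. -/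
theorem nm_dvd_res_nm {T A B C : FinGSet G} (f : A →[G] C) (g : B →[G] C) (a : T →[G] A)
    (b : T →[G] B) (h : ∀ t, f (a t) = g (b t)) (hi : ∀ s t, a s = a t → b s = b t → s = t)
    (x : R.obj A) : R.nm b (R.res a x) ∣ R.res g (R.nm f x) := by
  rw [R.res_nm _ _ _ _ (isCartesian_pullback f g)]
  have := R.nm_dvd_nm (pullbackLift f g a b h) (fun s t e => by
    have e' := congrArg Subtype.val e
    exact hi s t (congrArg Prod.fst e') (congrArg Prod.snd e')) (pullbackSnd f g)
    (R.res (pullbackFst f g) x)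
  rwa [← R.res_comp] at this

section Finite

variable [Finite G]

variable {R} in
/-- An element is determined by its restrictions to orbits. -/
theorem ext_orbit {X : FinGSet G} {a b : R.obj X}
    (h : ∀ (K : Subgroup G) (f : orbit K →[G] X), R.res f a = R.res f b) : a = b := by
  induction X using orbit_induction with
  | h0 X hX => exact (R.subsingleton_of_isEmpty X hX).elim a b
  | h1 K Y Z i j hij ih =>
    refine ext_of_isDisjointUnion hij (h K i) (ih fun L f => ?_)
    rw [← R.res_comp, ← R.res_comp, h]

/-- A norm absorbs an idempotent if its factors do. -/
theorem mul_nm_eq_self {X Y : FinGSet G} (f : X →[G] Y) (c : R.obj Y)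
    (x : R.obj X)
    (h : ∀ (K : Subgroup G) (k : orbit K →[G] X), c * R.nm (f.comp k) (R.res k x) = c) :
    c * R.nm f x = c := by
  induction X using orbit_induction with
  | h0 X hX =>
    have := R.subsingleton_of_isEmpty X hX
    rw [Subsingleton.elim x 1, map_one, mul_one]
  | h1 K X Z i j hij ih =>
    rw [nm_eq_mul hij, ← mul_assoc, h, ih]
    intro L k
    rw [← R.res_comp]
    exact h L (j.comp k)

end Finite

end TambaraFunctor

namespace FinGSet

variable {G : Type u} [Group G] (H : Subgroup G)

/-! ### Induction of finite `G`-sets -/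

/-- The element of `H` by which `g` moves from the chosen representative of `c` to the one of
`g • c`. -/
noncomputable def transition (g : G) (c : G ⧸ H) : H :=
  ⟨(g • c).out⁻¹ * g * c.out, by
    rw [mul_assoc, ← QuotientGroup.eq, QuotientGroup.out_eq']
    conv_lhs => rw [← QuotientGroup.out_eq' c]
    rfl⟩

theorem coe_transition (g : G) (c : G ⧸ H) :
    (transition H g c : G) = (g • c).out⁻¹ * g * c.out := rfl

variable [Finite G]

/-- The induced `G`-set `G ×_H X`. -/
noncomputable def induce (X : FinGSet H) : FinGSet G where
  carrier := (G ⧸ H) × X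
  action :=
    { smul := fun g z => (g • z.1, transition H g z.1 • z.2)
      one_smul := fun z => by
        refine Prod.ext (one_smul G z.1) ?_
        change transition H 1 z.1 • z.2 = z.2
        have : transition H 1 z.1 = 1 := Subtype.ext (by
          rw [coe_transition, one_smul]
          simp)
        rw [this, one_smul]
      mul_smul := fun a b z => by
        refine Prod.ext (mul_smul a b z.1) ?_
        change transition H (a * b) z.1 • z.2 = transition H a (b • z.1) • transition H b z.1 • z.2
        rw [← mul_smul]
        congr 1
        refine Subtype.ext ?_
        rw [Subgroup.coe_mul, coe_transition, coe_transition, coe_transition, mul_smul]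
        group }

variable {H}

/-- The map of induced `G`-sets given by a map of `H`-sets. -/
noncomputable def induceMap {X Y : FinGSet H} (f : X →[H] Y) : induce H X →[G] induce H Y where
  toFun z := (z.1, f z.2)
  map_smul' g z := Prod.ext rfl (map_smul f (transition H g z.1) z.2)

/-- The projection of an induced `G`-set to `G / H`. -/
noncomputable def induceBase (X : FinGSet H) : induce H X →[G] orbit H where
  toFun z := z.1
  map_smul' _ _ := rfl

theorem isCartesian_induceMap {P A B C : FinGSet H} {a : P →[H] A} {b : P →[H] B} {f : A →[H] C}
    {g : B →[H] C} (h : IsCartesian a b f g) :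
    IsCartesian (induceMap a) (induceMap b) (induceMap f) (induceMap g) := by
  refine ⟨fun w => Prod.ext rfl (h.1 w.2), ?_⟩
  rintro ⟨c, x⟩ ⟨c', y⟩ e
  obtain rfl : c = c' := congrArg Prod.fst e
  obtain ⟨w, ⟨h1, h2⟩, hu⟩ := h.2 x y (congrArg Prod.snd e)
  refine ⟨(c, w), ⟨Prod.ext rfl h1, Prod.ext rfl h2⟩, ?_⟩
  rintro ⟨c', w'⟩ ⟨h1', h2'⟩
  obtain rfl : c' = c := congrArg Prod.fst h1'
  exact Prod.ext rfl (hu w' ⟨congrArg Prod.snd h1', congrArg Prod.snd h2'⟩)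

theorem isDisjointUnion_induceMap {X Y Z : FinGSet H} {i : X →[H] Z} {j : Y →[H] Z}
    (h : IsDisjointUnion i j) : IsDisjointUnion (induceMap i) (induceMap j) := by
  rw [isDisjointUnion_iff] at h ⊢
  obtain ⟨h1, h2, h3, h4⟩ := h
  refine ⟨fun x y e => Prod.ext (congrArg Prod.fst e :) (h1 (congrArg Prod.snd e)),
    fun x y e => Prod.ext (congrArg Prod.fst e :) (h2 (congrArg Prod.snd e)),
    fun x y e => h3 _ _ (congrArg Prod.snd e), ?_⟩
  rintro ⟨c, z⟩
  obtain ⟨x, rfl⟩ | ⟨y, rfl⟩ := h4 z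
  · exact Or.inl ⟨(c, x), rfl⟩
  · exact Or.inr ⟨(c, y), rfl⟩

theorem isExponential_induceMap {A X Y P Q : FinGSet H} {p : A →[H] X} {f : X →[H] Y}
    {e : P →[H] A} {f' : P →[H] Q} {q : Q →[H] Y} (h : IsExponential p f e f' q) :
    IsExponential (induceMap p) (induceMap f) (induceMap e) (induceMap f') (induceMap q) := by
  refine ⟨isCartesian_induceMap h.1, ?_⟩
  rintro ⟨c, y⟩ s hs
  have hs1 : ∀ x, (s x).1 = x.1.1 := fun x => congrArg Prod.fst (hs x)
  have hs2 : ∀ x, p (s x).2 = x.1.2 := fun x => congrArg Prod.snd (hs x)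
  obtain ⟨z, ⟨hz, hz'⟩, hu⟩ := h.2 y
    (fun x => (s ⟨(c, x.1), Prod.ext rfl x.2⟩).2) (fun x => hs2 _)
  refine ⟨(c, z), ⟨Prod.ext rfl hz, ?_⟩, ?_⟩
  · rintro ⟨⟨c', x⟩, hx⟩ ⟨c'', w⟩ hw hwx
    obtain rfl : c' = c := congrArg Prod.fst hx
    obtain rfl : c'' = c' := congrArg Prod.fst hw
    exact Prod.ext (hs1 ⟨(_, x), hx⟩).symm
      (hz' ⟨x, congrArg Prod.snd hx⟩ w (congrArg Prod.snd hw) (congrArg Prod.snd hwx))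
  · rintro ⟨c', z'⟩ ⟨h1, h2⟩
    obtain rfl : c' = c := congrArg Prod.fst h1
    refine Prod.ext rfl (hu z' ⟨congrArg Prod.snd h1, fun x w hw hwx => ?_⟩)
    exact congrArg Prod.snd (h2 ⟨(c', x.1), Prod.ext rfl x.2⟩ (c', w) (Prod.ext rfl hw)
      (Prod.ext rfl hwx))

variable (H) in
/-- The chosen representative of the trivial coset. -/
noncomputable def baseRep : H :=
  ⟨((1 : G) : G ⧸ H).out, by
    have := QuotientGroup.out_eq' ((1 : G) : G ⧸ H)
    rw [eq_comm, QuotientGroup.eq] at this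
    simpa using this⟩

/-- The unit of the adjunction between induction and restriction. -/
noncomputable def induceUnit (X : FinGSet H) : X →[H] restrict H (induce H X) where
  toFun x := (((1 : G) : G ⧸ H), (baseRep H)⁻¹ • x)
  map_smul' h x := by
    have h1 : (h : G) • ((1 : G) : G ⧸ H) = ((1 : G) : G ⧸ H) := by
      change (((h : G) * 1 : G) : G ⧸ H) = _
      rw [QuotientGroup.eq]
      simp
    refine Prod.ext h1.symm ?_
    change (baseRep H)⁻¹ • h • x = transition H h ((1 : G) : G ⧸ H) • (baseRep H)⁻¹ • x
    rw [← mul_smul, ← mul_smul]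
    refine congrArg (· • x) (Subtype.ext ?_)
    rw [Subgroup.coe_mul, Subgroup.coe_mul, coe_transition, h1, Subgroup.coe_inv, baseRep]
    group

theorem induceUnit_injective (X : FinGSet H) : Function.Injective (induceUnit X) := by
  intro x y h
  exact smul_left_cancel _ (congrArg Prod.snd h)

/-- The unit identifies `X` with the part of `G ×_H X` over the trivial coset. Base change along
this square makes `unitHom` compatible with transfers and norms. -/
theorem isCartesian_induceUnit {X Y : FinGSet H} (f : X →[H] Y) :
    IsCartesian (induceUnit X) f (restrictMap H (induceMap f)) (induceUnit Y) := by
  refine ⟨fun x => Prod.ext rfl (map_smul f _ x), ?_⟩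
  rintro ⟨c, x⟩ y h
  obtain rfl : c = ((1 : G) : G ⧸ H) := congrArg Prod.fst h
  have h2 : f x = (baseRep H)⁻¹ • y := congrArg Prod.snd h
  refine ⟨baseRep H • x, ⟨Prod.ext rfl ?_, ?_⟩, ?_⟩
  · exact inv_smul_smul _ x
  · rw [map_smul, h2, smul_inv_smul]
  · rintro w ⟨h1, -⟩
    have h1' : (baseRep H)⁻¹ • w = x := congrArg Prod.snd h1
    rw [← h1', smul_inv_smul]

/-- The map out of an induced `G`-set that corresponds to a map of `H`-sets. -/
noncomputable def induceLift {X : FinGSet H} {Y : FinGSet G} (f : X →[H] restrict H Y) :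
    induce H X →[G] Y where
  toFun z := (z.1.out • (show Y from f z.2) : Y)
  map_smul' g z := by
    change (g • z.1).out • (show Y from f (transition H g z.1 • z.2)) =
      g • z.1.out • (show Y from f z.2)
    rw [map_smul]
    change (g • z.1).out • ((transition H g z.1 : G) • (show Y from f z.2)) = _
    rw [coe_transition, ← mul_smul, ← mul_smul]
    congr 1
    group

theorem induceLift_unit {X : FinGSet H} {Y : FinGSet G} (f : X →[H] restrict H Y) :
    (restrictMap H (induceLift f)).comp (induceUnit X) = f := by
  ext x
  change ((1 : G) : G ⧸ H).out • (show Y from f (_ • x)) = f x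
  rw [map_smul]
  change ((1 : G) : G ⧸ H).out • (((1 : G) : G ⧸ H).out)⁻¹ • (show Y from f x) = f x
  rw [smul_inv_smul]

/-- The counit of the adjunction between induction and restriction. -/
noncomputable def induceCounit (H : Subgroup G) (X : FinGSet G) : induce H (restrict H X) →[G] X :=
  induceLift (MulActionHom.id H)

/-- For a `G`-set `X` the induced set is `G/H × X`, and the counit becomes the second projection. -/
theorem isCartesian_induceCounit {X Y : FinGSet G} (f : X →[G] Y) :
    IsCartesian (induceCounit H X) (induceMap (restrictMap H f)) f (induceCounit H Y) := by
  refine ⟨fun z => map_smul f _ _, ?_⟩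
  rintro x ⟨c, y⟩ h
  have h' : f x = c.out • (show Y from y) := h
  refine ⟨(c, c.out⁻¹ • x), ⟨smul_inv_smul _ x, Prod.ext rfl ?_⟩, ?_⟩
  · change f (c.out⁻¹ • x) = y
    rw [map_smul, h', inv_smul_smul]
  · rintro ⟨c', z⟩ ⟨h1, h2⟩
    obtain rfl : c' = c := congrArg Prod.fst h2
    have h1' : c'.out • (show X from z) = x := h1
    refine Prod.ext rfl ?_
    rw [← h1', inv_smul_smul]

theorem isCartesian_induceBase (X : FinGSet G) (f : orbit H →[G] orbit (⊤ : Subgroup G))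
    (g : X →[G] orbit (⊤ : Subgroup G)) :
    IsCartesian (induceBase (restrict H X)) (induceCounit H X) f g := by
  have hs : Subsingleton (G ⧸ (⊤ : Subgroup G)) := QuotientGroup.subsingleton_quotient_top
  refine ⟨fun w => hs.elim _ _, fun c x _ => ?_⟩
  refine ⟨((show G ⧸ H from c), (show G ⧸ H from c).out⁻¹ • x), ⟨rfl, smul_inv_smul _ x⟩, ?_⟩
  rintro ⟨c', z⟩ ⟨h1, h2⟩
  obtain rfl : c' = c := h1
  have h2' : c'.out • (show X from z) = x := h2
  refine Prod.ext rfl ?_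
  rw [← h2', inv_smul_smul]

end FinGSet

namespace TambaraFunctor

open FinGSet

variable {G : Type u} [Group G]

section

variable {H : Subgroup G} {R : TambaraFunctor.{u, v} G} {S : TambaraFunctor.{u, v} H}

/-- The components of an isomorphism with a coinduced functor. -/
def coindEquiv (Φ : Iso R (coind H S)) (X : FinGSet G) : R.obj X ≃+* S.obj (restrict H X) :=
  Φ.equiv X

theorem coindEquiv_res (Φ : Iso R (coind H S)) {X Y : FinGSet G} (f : X →[G] Y) (a : R.obj Y) :
    coindEquiv Φ X (R.res f a) = S.res (restrictMap H f) (coindEquiv Φ Y a) := Φ.map_res f a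

theorem coindEquiv_tr (Φ : Iso R (coind H S)) {X Y : FinGSet G} (f : X →[G] Y) (a : R.obj X) :
    coindEquiv Φ Y (R.tr f a) = S.tr (restrictMap H f) (coindEquiv Φ X a) := Φ.map_tr f a

theorem coindEquiv_nm (Φ : Iso R (coind H S)) {X Y : FinGSet G} (f : X →[G] Y) (a : R.obj X) :
    coindEquiv Φ Y (R.nm f a) = S.nm (restrictMap H f) (coindEquiv Φ X a) := Φ.map_nm f a

end

variable [Finite G]

/-! ### Extension of Tambara ideals to all finite `G`-sets -/

namespace TambaraIdeal

variable {R : TambaraFunctor.{u, v} G}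

/-- The value of a Tambara ideal at an arbitrary finite `G`-set. -/
def extend (I : TambaraIdeal R) (X : FinGSet G) : Ideal (R.obj X) :=
  ⨅ (K : Subgroup G) (f : orbit K →[G] X), (I.ideal K).comap (R.res f)

theorem mem_extend {I : TambaraIdeal R} {X : FinGSet G} {x : R.obj X} :
    x ∈ I.extend X ↔ ∀ (K : Subgroup G) (f : orbit K →[G] X), R.res f x ∈ I.ideal K := by
  simp only [extend, Submodule.mem_iInf, Ideal.mem_comap]

theorem mem_extend_orbit {I : TambaraIdeal R} {K : Subgroup G} {x : R.obj (orbit K)} :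
    x ∈ I.extend (orbit K) ↔ x ∈ I.ideal K := by
  rw [mem_extend]
  constructor
  · intro h
    rw [← R.res_id x]
    exact h K (MulActionHom.id G)
  · exact fun h L f => I.res_mem f h

theorem res_mem_extend (I : TambaraIdeal R) {X Y : FinGSet G} (f : X →[G] Y) {y : R.obj Y}
    (hy : y ∈ I.extend Y) : R.res f y ∈ I.extend X := by
  rw [mem_extend] at hy ⊢
  intro K g
  rw [← R.res_comp]
  exact hy K _

theorem tr_mem_of_mem_extend (I : TambaraIdeal R) {X : FinGSet G} {K : Subgroup G}
    (f : X →[G] orbit K) {x : R.obj X} (hx : x ∈ I.extend X) : R.tr f x ∈ I.ideal K := by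
  induction X using orbit_induction with
  | h0 X hX =>
    have := R.subsingleton_of_isEmpty X hX
    rw [Subsingleton.elim x 0, map_zero]
    exact zero_mem _
  | h1 L X Z i j hij ih =>
    rw [tr_eq_add hij]
    exact add_mem (I.tr_mem _ (mem_extend.mp hx L i)) (ih _ (I.res_mem_extend j hx))

/-- The norm is a product over orbits, so a single orbit with norm in `I` suffices. Nonemptiness is
essential because the norm from the empty set is `1`. -/
theorem nm_mem_of_mem_extend (I : TambaraIdeal R) {X : FinGSet G} [hX : Nonempty X]
    {K : Subgroup G} (f : X →[G] orbit K) {x : R.obj X} (hx : x ∈ I.extend X) :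
    R.nm f x ∈ I.ideal K := by
  obtain ⟨p⟩ := hX
  exact Ideal.mem_of_dvd _ (R.nm_dvd_nm (orbitIncl p) (orbitIncl_injective p) f x)
    (I.nm_mem _ (mem_extend.mp hx _ _))

theorem tr_mem_extend (I : TambaraIdeal R) {X Y : FinGSet G} (f : X →[G] Y) {x : R.obj X}
    (hx : x ∈ I.extend X) : R.tr f x ∈ I.extend Y := by
  rw [mem_extend]
  intro K g
  rw [R.res_tr _ _ _ _ (isCartesian_pullback f g)]
  exact I.tr_mem_of_mem_extend _ (I.res_mem_extend _ hx)

theorem nm_mem_extend (I : TambaraIdeal R) {X Y : FinGSet G} (f : X →[G] Y)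
    (hf : Function.Surjective f) {x : R.obj X} (hx : x ∈ I.extend X) :
    R.nm f x ∈ I.extend Y := by
  rw [mem_extend]
  intro K g
  rw [R.res_nm _ _ _ _ (isCartesian_pullback f g)]
  obtain ⟨p, hp⟩ := hf (g (pt K))
  have : Nonempty (pullback f g) := ⟨⟨(p, pt K), hp⟩⟩
  exact I.nm_mem_of_mem_extend _ (I.res_mem_extend _ hx)

theorem mul_le_iff {I J P : TambaraIdeal R} :
    I * J ≤ P ↔ ∀ K, ∀ a ∈ I.ideal K, ∀ b ∈ J.ideal K, a * b ∈ P.ideal K := by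
  constructor
  · intro h K a ha b hb
    refine h K ?_
    change a * b ∈ (⨅ (I : TambaraIdeal R) (_ : _), I.ideal K)
    simp only [Submodule.mem_iInf]
    exact fun L hL => hL K ⟨a, ha, b, hb, rfl⟩
  · intro h K x hx
    change x ∈ (⨅ (I : TambaraIdeal R) (_ : _), I.ideal K) at hx
    simp only [Submodule.mem_iInf] at hx
    refine hx P fun L => ?_
    rintro _ ⟨a, ha, b, hb, rfl⟩
    exact h L a ha b hb

theorem mem_bot {K : Subgroup G} {x : R.obj (orbit K)} :
    x ∈ (⊥ : TambaraIdeal R).ideal K ↔ x = 0 := Ideal.mem_bot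

theorem mul_eq_zero_of_mem_extend {I J : TambaraIdeal R} (h : I * J ≤ ⊥) {X : FinGSet G}
    {x y : R.obj X} (hx : x ∈ I.extend X) (hy : y ∈ J.extend X) : x * y = 0 := by
  refine ext_orbit fun K f => ?_
  rw [map_mul, map_zero]
  exact mul_le_iff.mp h K _ (mem_extend.mp hx K f) _ (mem_extend.mp hy K f)

end TambaraIdeal

theorem isDomainLike_iff (R : TambaraFunctor.{u, v} G) :
    R.IsDomainLike ↔ (∃ K, (1 : R.obj (orbit K)) ≠ 0) ∧
      ∀ I J : TambaraIdeal R, I * J ≤ ⊥ → I ≤ ⊥ ∨ J ≤ ⊥ := by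
  unfold IsDomainLike TambaraIdeal.IsPrime
  refine and_congr_left fun _ => exists_congr fun K => not_congr ?_
  rw [Ideal.eq_top_iff_one, TambaraIdeal.mem_bot]

theorem exists_one_ne_zero {R : TambaraFunctor.{u, v} G} {X : FinGSet G}
    (h : (1 : R.obj X) ≠ 0) : ∃ K, (1 : R.obj (orbit K)) ≠ 0 := by
  by_contra! hK
  refine h (ext_orbit fun K f => ?_)
  rw [map_one, map_zero, hK]

/-! ### Domain-like functors and coinduction -/

section Coinduction

variable {H : Subgroup G} {R : TambaraFunctor.{u, v} G} {S : TambaraFunctor.{u, v} H}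

/-- The Tambara ideal of a coinduced functor that is coinduced from a Tambara ideal. -/
def coindIdeal (Φ : Iso R (coind H S)) (I : TambaraIdeal S) : TambaraIdeal R where
  ideal K := (I.extend (restrict H (orbit K))).comap (coindEquiv Φ (orbit K)).toRingHom
  res_mem f a ha := by
    change coindEquiv Φ _ a ∈ I.extend _ at ha
    change coindEquiv Φ _ _ ∈ I.extend _
    rw [coindEquiv_res]
    exact I.res_mem_extend (restrictMap H f) ha
  tr_mem f a ha := by
    change coindEquiv Φ _ a ∈ I.extend _ at ha
    change coindEquiv Φ _ _ ∈ I.extend _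
    rw [coindEquiv_tr]
    exact I.tr_mem_extend (restrictMap H f) ha
  nm_mem f a ha := by
    change coindEquiv Φ _ a ∈ I.extend _ at ha
    change coindEquiv Φ _ _ ∈ I.extend _
    rw [coindEquiv_nm]
    exact I.nm_mem_extend (restrictMap H f) (orbit_hom_surjective f) ha

theorem mem_coindIdeal (Φ : Iso R (coind H S)) (I : TambaraIdeal S) {K : Subgroup G}
    {x : R.obj (orbit K)} :
    x ∈ (coindIdeal Φ I).ideal K ↔ coindEquiv Φ _ x ∈ I.extend (restrict H (orbit K)) := Iff.rfl

/-- The ring homomorphism `R(G ×_H X) → S(X)` for an isomorphism of `R` with `CoInd_H^G S`. -/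
noncomputable def unitHom (Φ : Iso R (coind H S)) (X : FinGSet H) :
    R.obj (induce H X) →+* S.obj X :=
  (S.res (induceUnit X)).comp (coindEquiv Φ (induce H X)).toRingHom

theorem unitHom_apply (Φ : Iso R (coind H S)) (X : FinGSet H) (x : R.obj (induce H X)) :
    unitHom Φ X x = S.res (induceUnit X) (coindEquiv Φ _ x) := rfl

theorem unitHom_surjective (Φ : Iso R (coind H S)) (X : FinGSet H) :
    Function.Surjective (unitHom Φ X) := fun x =>
  ⟨(coindEquiv Φ _).symm (S.tr (induceUnit X) x), by
    rw [unitHom_apply, RingEquiv.apply_symm_apply]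
    exact S.res_tr_of_injective _ (induceUnit_injective X) x⟩

theorem unitHom_res (Φ : Iso R (coind H S)) {X Y : FinGSet H} (f : X →[H] Y)
    (y : R.obj (induce H Y)) :
    S.res f (unitHom Φ Y y) = unitHom Φ X (R.res (induceMap f) y) := by
  rw [unitHom_apply, unitHom_apply, coindEquiv_res, ← S.res_comp, ← S.res_comp]
  congr 2
  ext x
  exact ((isCartesian_induceUnit f).1 x).symm

theorem unitHom_tr (Φ : Iso R (coind H S)) {X Y : FinGSet H} (f : X →[H] Y)
    (x : R.obj (induce H X)) :
    S.tr f (unitHom Φ X x) = unitHom Φ Y (R.tr (induceMap f) x) := by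
  rw [unitHom_apply, unitHom_apply, coindEquiv_tr]
  exact (S.res_tr _ _ _ _ (isCartesian_induceUnit f) _).symm

theorem unitHom_nm (Φ : Iso R (coind H S)) {X Y : FinGSet H} (f : X →[H] Y)
    (x : R.obj (induce H X)) :
    S.nm f (unitHom Φ X x) = unitHom Φ Y (R.nm (induceMap f) x) := by
  rw [unitHom_apply, unitHom_apply, coindEquiv_nm]
  exact (S.res_nm _ _ _ _ (isCartesian_induceUnit f) _).symm

/-- The Tambara ideal of `S` given by a Tambara ideal of the coinduced functor. -/
noncomputable def unitIdeal (Φ : Iso R (coind H S)) (I : TambaraIdeal R) : TambaraIdeal S where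
  ideal K := (I.extend (induce H (orbit K))).map (unitHom Φ (orbit K))
  res_mem f a ha := by
    rw [Ideal.mem_map_iff_of_surjective _ (unitHom_surjective Φ _)] at ha ⊢
    obtain ⟨x, hx, rfl⟩ := ha
    exact ⟨_, I.res_mem_extend (induceMap f) hx, (unitHom_res Φ f x).symm⟩
  tr_mem f a ha := by
    rw [Ideal.mem_map_iff_of_surjective _ (unitHom_surjective Φ _)] at ha ⊢
    obtain ⟨x, hx, rfl⟩ := ha
    exact ⟨_, I.tr_mem_extend (induceMap f) hx, (unitHom_tr Φ f x).symm⟩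
  nm_mem f a ha := by
    rw [Ideal.mem_map_iff_of_surjective _ (unitHom_surjective Φ _)] at ha ⊢
    obtain ⟨x, hx, rfl⟩ := ha
    refine ⟨_, I.nm_mem_extend (induceMap f) ?_ hx, (unitHom_nm Φ f x).symm⟩
    rintro ⟨c, y⟩
    obtain ⟨x, rfl⟩ := orbit_hom_surjective f y
    exact ⟨(c, x), rfl⟩

theorem mem_unitIdeal (Φ : Iso R (coind H S)) (I : TambaraIdeal R) {K : Subgroup H}
    {x : S.obj (orbit K)} :
    x ∈ (unitIdeal Φ I).ideal K ↔ ∃ y ∈ I.extend (induce H (orbit K)), unitHom Φ _ y = x :=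
  Ideal.mem_map_iff_of_surjective _ (unitHom_surjective Φ _)

/-- Ideals of `S` are coinduced to `R`. If the coinduced ideal vanishes, so does `I`: extension by
zero along the unit `H/L → G ×_H (H/L)` keeps an element in the extended ideal, and restriction
along the unit recovers it. -/
theorem isDomainLike_of_coind (Φ : Iso R (coind H S)) (h : R.IsDomainLike) : S.IsDomainLike := by
  rw [isDomainLike_iff] at h ⊢
  obtain ⟨⟨K, hK⟩, h⟩ := h
  refine ⟨exists_one_ne_zero (X := restrict H (orbit K)) fun e => hK ?_, fun I J hIJ => ?_⟩
  · refine (coindEquiv Φ _).injective ?_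
    rw [map_one, map_zero]
    exact e
  · have key (I : TambaraIdeal S) (hI : coindIdeal Φ I ≤ ⊥) : I ≤ ⊥ := by
      intro L x hx
      have hy : S.tr (induceUnit (orbit L)) x ∈ I.extend (restrict H (induce H (orbit L))) :=
        I.tr_mem_extend _ (TambaraIdeal.mem_extend_orbit.mpr hx)
      obtain ⟨y, hy'⟩ :=
        (coindEquiv Φ (induce H (orbit L))).surjective (S.tr (induceUnit (orbit L)) x)
      have hy0 : y = 0 := by
        refine ext_orbit fun K f => ?_
        rw [map_zero]
        refine hI K ?_
        rw [mem_coindIdeal, coindEquiv_res, hy']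
        exact I.res_mem_extend (restrictMap H f) hy
      rw [TambaraIdeal.mem_bot, ← S.res_tr_of_injective _ (induceUnit_injective _) x, ← hy', hy0,
        map_zero, map_zero]
    refine (h (coindIdeal Φ I) (coindIdeal Φ J) ?_).imp (key I) (key J)
    rw [TambaraIdeal.mul_le_iff]
    intro K a ha b hb
    rw [TambaraIdeal.mem_bot]
    refine (coindEquiv Φ _).injective ?_
    rw [map_mul, map_zero]
    exact TambaraIdeal.mul_eq_zero_of_mem_extend hIJ ha hb

/-- Ideals of `R` are carried to `S` by `unitHom`. Nothing is lost, since every `H`-map from an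
orbit to a `G`-set factors through the unit of that orbit, so the images in `S` detect zero. -/
theorem isDomainLike_coind (Φ : Iso R (coind H S)) (h : S.IsDomainLike) : R.IsDomainLike := by
  rw [isDomainLike_iff] at h ⊢
  obtain ⟨⟨K, hK⟩, h⟩ := h
  refine ⟨exists_one_ne_zero (X := induce H (orbit K)) fun e => hK ?_, fun I J hIJ => ?_⟩
  · rw [← map_one (unitHom Φ _), e, map_zero]
  · have key (I : TambaraIdeal R) (hI : unitIdeal Φ I ≤ ⊥) : I ≤ ⊥ := by
      intro L x hx
      rw [TambaraIdeal.mem_bot]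
      refine (coindEquiv Φ _).injective ?_
      rw [map_zero]
      refine ext_orbit fun K f => ?_
      have : S.res f (coindEquiv Φ _ x) = unitHom Φ (orbit K) (R.res (induceLift f) x) := by
        rw [unitHom_apply, coindEquiv_res, ← S.res_comp, induceLift_unit]
      refine (this.trans (hI K ?_)).trans (map_zero (S.res f)).symm
      rw [mem_unitIdeal]
      exact ⟨_, I.res_mem_extend _ (TambaraIdeal.mem_extend_orbit.mpr hx), rfl⟩
    refine (h (unitIdeal Φ I) (unitIdeal Φ J) ?_).imp (key I) (key J)
    rw [TambaraIdeal.mul_le_iff]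
    intro K a ha b hb
    rw [mem_unitIdeal] at ha hb
    obtain ⟨x, hx, rfl⟩ := ha
    obtain ⟨y, hy, rfl⟩ := hb
    rw [TambaraIdeal.mem_bot, ← map_mul, TambaraIdeal.mul_eq_zero_of_mem_extend hIJ hx hy,
      map_zero]

end Coinduction

end TambaraFunctor

namespace TambaraFunctor

open FinGSet

/-! ### Restriction to a subgroup -/

section Restriction

variable {G : Type u} [Group G] [Finite G]

/-- The restriction of a `G`-Tambara functor to a subgroup `H`, with value `R(G ×_H X)` at `X`. -/
noncomputable def restrictGroup (R : TambaraFunctor.{u, v} G) (H : Subgroup G) :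
    TambaraFunctor.{u, v} H where
  obj X := R.obj (induce H X)
  res f := R.res (induceMap f)
  tr f := R.tr (induceMap f)
  nm f := R.nm (induceMap f)
  res_id := R.res_id
  tr_id := R.tr_id
  nm_id := R.nm_id
  res_comp g f := R.res_comp (induceMap g) (induceMap f)
  tr_comp g f := R.tr_comp (induceMap g) (induceMap f)
  nm_comp g f := R.nm_comp (induceMap g) (induceMap f)
  subsingleton_of_isEmpty X h := R.subsingleton_of_isEmpty (induce H X) ⟨fun z => h.elim z.2⟩
  bijective_of_isDisjointUnion _ _ h :=
    R.bijective_of_isDisjointUnion _ _ (isDisjointUnion_induceMap h)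
  res_tr _ _ _ _ h := R.res_tr _ _ _ _ (isCartesian_induceMap h)
  res_nm _ _ _ _ h := R.res_nm _ _ _ _ (isCartesian_induceMap h)
  nm_tr _ _ _ _ _ h := R.nm_tr _ _ _ _ _ (isExponential_induceMap h)

end Restriction

/-! ### Corners -/

variable {G : Type u} [Group G]

/-- A family of idempotents that is compatible with restrictions and absorbs norms. -/
structure IdempotentFamily (R : TambaraFunctor.{u, v} G) where
  e : ∀ X : FinGSet G, R.obj X
  idem : ∀ X, IsIdempotentElem (e X)
  res_e : ∀ {X Y : FinGSet G} (f : X →[G] Y), R.res f (e Y) = e X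
  nm_e : ∀ {X Y : FinGSet G} (f : X →[G] Y), R.nm f (e X) * e Y = e Y

theorem _root_.IsIdempotentElem.Corner.mul_eq {A : Type*} [CommRing A] {e : A}
    {h : IsIdempotentElem e} (x : h.Corner) : x.1 * e = x.1 :=
  ((Subsemigroup.mem_corner_iff h).mp x.2).2

/-- An element of a commutative ring absorbing an idempotent, as an element of its corner. -/
def _root_.IsIdempotentElem.toCorner {A : Type*} [CommRing A] {e : A}
    (h : IsIdempotentElem e) (a : A) (ha : a * e = a) : h.Corner :=
  ⟨a, (Subsemigroup.mem_corner_iff h).mpr ⟨by rw [mul_comm, ha], ha⟩⟩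

variable {R : TambaraFunctor.{u, v} G} (E : IdempotentFamily R)

namespace IdempotentFamily

/-- Cutting down before a norm has no effect once the result is cut down. Hence the truncated norms
of the corner compose. -/
theorem nm_mul_e {X Y : FinGSet G} (f : X →[G] Y) (x : R.obj X) :
    R.nm f (x * E.e X) * E.e Y = R.nm f x * E.e Y := by
  rw [map_mul, mul_assoc, E.nm_e]

/-- The corner of a Tambara functor at a family of idempotents. -/
def corner : TambaraFunctor.{u, v} G where
  obj X := (E.idem X).Corner
  res {X Y} f :=
    { toFun := fun y => (E.idem X).toCorner (R.res f y.1) (by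
        rw [← E.res_e f, ← map_mul, y.mul_eq])
      map_one' := Subtype.ext (E.res_e f)
      map_mul' := fun x y => Subtype.ext (map_mul (R.res f) x.1 y.1)
      map_zero' := Subtype.ext (map_zero (R.res f))
      map_add' := fun x y => Subtype.ext (map_add (R.res f) x.1 y.1) }
  tr {X Y} f :=
    { toFun := fun x => (E.idem Y).toCorner (R.tr f x.1) (by
        rw [tr_mul, E.res_e, x.mul_eq])
      map_zero' := Subtype.ext (map_zero (R.tr f))
      map_add' := fun x y => Subtype.ext (map_add (R.tr f) x.1 y.1) }
  nm {X Y} f :=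
    { toFun := fun x => (E.idem Y).toCorner (R.nm f x.1 * E.e Y) (by
        rw [mul_assoc, E.idem])
      map_one' := Subtype.ext (E.nm_e f)
      map_mul' := fun x y => Subtype.ext (by
        change R.nm f (x.1 * y.1) * E.e Y = R.nm f x.1 * E.e Y * (R.nm f y.1 * E.e Y)
        rw [map_mul, mul_mul_mul_comm, E.idem]) }
  res_id a := Subtype.ext (R.res_id a.1)
  tr_id a := Subtype.ext (R.tr_id a.1)
  nm_id {X} a := Subtype.ext (by
    change R.nm _ a.1 * E.e X = a.1
    rw [R.nm_id, a.mul_eq])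
  res_comp g f a := Subtype.ext (R.res_comp g f a.1)
  tr_comp g f a := Subtype.ext (R.tr_comp g f a.1)
  nm_comp {X Y Z} g f a := Subtype.ext (by
    change R.nm (g.comp f) a.1 * E.e Z = R.nm g (R.nm f a.1 * E.e Y) * E.e Z
    rw [nm_mul_e, R.nm_comp])
  subsingleton_of_isEmpty X h :=
    have := R.subsingleton_of_isEmpty X h
    ⟨fun a b => Subtype.ext (Subsingleton.elim a.1 b.1)⟩
  bijective_of_isDisjointUnion {X Y Z} i j h := by
    constructor
    · intro a b hab
      exact Subtype.ext (ext_of_isDisjointUnion h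
        (congrArg (fun p => p.1.1) hab) (congrArg (fun p => p.2.1) hab))
    · rintro ⟨x, y⟩
      obtain ⟨z, hz⟩ := (R.bijective_of_isDisjointUnion i j h).2 (x.1, y.1)
      have h1 : R.res i z = x.1 := congrArg Prod.fst hz
      have h2 : R.res j z = y.1 := congrArg Prod.snd hz
      refine ⟨(E.idem Z).toCorner z (ext_of_isDisjointUnion h ?_ ?_),
        Prod.ext (Subtype.ext h1) (Subtype.ext h2)⟩
      · rw [map_mul, E.res_e, h1, x.mul_eq]
      · rw [map_mul, E.res_e, h2, y.mul_eq]
  res_tr a b f g h t := Subtype.ext (R.res_tr a b f g h t.1)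
  res_nm {P A B C} a b f g h t := Subtype.ext (by
    change R.res g (R.nm f t.1 * E.e C) = R.nm b (R.res a t.1) * E.e B
    rw [map_mul, E.res_e, R.res_nm a b f g h])
  nm_tr {A X Y P Q} p f e f' q h t := Subtype.ext (by
    change R.nm f (R.tr p t.1) * E.e Y = R.tr q (R.nm f' (R.res e t.1) * E.e Q)
    rw [R.nm_tr p f e f' q h, tr_mul, E.res_e])

theorem corner_ext {X : FinGSet G} {a b : E.corner.obj X} (h : a.1 = b.1) : a = b := Subtype.ext h

theorem corner_mul_e {X : FinGSet G} (a : E.corner.obj X) : a.1 * E.e X = a.1 :=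
  IsIdempotentElem.Corner.mul_eq (h := E.idem X) a

end IdempotentFamily

/-! ### Idempotents in a ring with an action of a finite group -/

/-- In a nonzero commutative ring with an action of a finite group there is a nonzero idempotent
that is orthogonal to its translates outside of its stabilizer and such that no nonzero idempotent
below it is orthogonal to a translate by an element of the stabilizer. -/
theorem exists_idempotent_with_orthogonal_translates [Finite G] {A : Type v} [CommRing A]
    [Nontrivial A] (c : G →* (A →+* A)) :
    ∃ (H : Subgroup G) (d : A), d ≠ 0 ∧ d * d = d ∧ (∀ h ∈ H, c h d = d) ∧
      (∀ g ∉ H, d * c g d = 0) ∧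
      ∀ d', d' ≠ 0 → d' * d' = d' → d' * d = d' → ∀ h ∈ H, d' * c h d' ≠ 0 := by
  have c1 (x : A) : c 1 x = x := by rw [map_one]; rfl
  have cm (g h : G) (x : A) : c (g * h) x = c g (c h x) := by rw [map_mul]; rfl
  let D : Set A := {d | d ≠ 0 ∧ d * d = d}
  -- Passing to a smaller idempotent enlarges `T`. Once `T d₀` is maximal, all nonzero idempotents
  -- below `d₀` have the same `T`.
  let T : A → Set G := fun d => {g | d * c g d = 0}
  obtain ⟨_, ⟨d₀, ⟨hd₀, hd₀'⟩, rfl⟩, hmax⟩ := (Set.toFinite (T '' D)).exists_maximal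
    ⟨_, ⟨1, ⟨one_ne_zero, mul_one 1⟩, rfl⟩⟩
  have hle : ∀ d', d' * d₀ = d' → T d₀ ⊆ T d' := by
    intro d' h g hg
    change d' * c g d' = 0
    rw [← h, map_mul, mul_mul_mul_comm, show d₀ * c g d₀ = 0 from hg, mul_zero]
  have hT : ∀ d', d' ≠ 0 → d' * d' = d' → d' * d₀ = d' → T d' = T d₀ := fun d' h1 h2 h3 =>
    (hmax ⟨d', ⟨h1, h2⟩, rfl⟩ (hle d' h3)).antisymm (hle d' h3)
  have hinv : ∀ g, d₀ * c g⁻¹ d₀ = 0 → d₀ * c g d₀ = 0 := by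
    intro g h
    have := congrArg (c g) h
    rwa [map_mul, ← cm, mul_inv_cancel, c1, map_zero, mul_comm] at this
  let H : Subgroup G :=
    { carrier := {g | d₀ * c g d₀ ≠ 0}
      one_mem' := by
        change d₀ * c 1 d₀ ≠ 0
        rwa [c1, hd₀']
      mul_mem' := by
        intro g h hg hh hgh
        have hg' : g⁻¹ ∉ T d₀ := fun h' => hg (hinv g h')
        -- If `g * h` were orthogonalizing, then `c g⁻¹ d₀` and `c h d₀` would be orthogonal. So `h`
        -- would lie in `T` of the nonzero idempotent `d₀ * c g⁻¹ d₀`, hence in `T d₀`.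
        have e' : T (d₀ * c g⁻¹ d₀) = T d₀ := hT _ hg'
          (by rw [mul_mul_mul_comm, hd₀', ← map_mul, hd₀'])
          (by rw [mul_right_comm, hd₀'])
        have hm : h ∈ T (d₀ * c g⁻¹ d₀) := by
          change d₀ * c g⁻¹ d₀ * c h (d₀ * c g⁻¹ d₀) = 0
          have : c g⁻¹ d₀ * c h d₀ = 0 := by
            rw [← map_zero (c g⁻¹), ← hgh, map_mul, ← cm, inv_mul_cancel_left]
          rw [map_mul]
          linear_combination d₀ * c h (c g⁻¹ d₀) * this
        rw [e'] at hm
        exact hh hm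
      inv_mem' := by
        intro g hg h
        exact hg (hinv g h) }
  -- The product of all `H`-translates of `d₀` must be shown nonzero. Multiplying `d'` by `c h d'`
  -- keeps it nonzero, as `T d' = T d₀`, and puts it below one more translate.
  have hfin (s : Finset H) : ∃ d', d' ≠ 0 ∧ d' * d' = d' ∧ d' * d₀ = d' ∧
      ∀ h ∈ s, d' * c h d₀ = d' := by
    classical
    induction s using Finset.induction_on with
    | empty => exact ⟨d₀, hd₀, hd₀', hd₀', by simp⟩
    | insert h s hs ih =>
      obtain ⟨d', h1, h2, h3, h4⟩ := ih
      have hh : (h : G) ∉ T d' := by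
        rw [hT d' h1 h2 h3]
        exact h.2
      refine ⟨d' * c h d', hh, by rw [mul_mul_mul_comm, h2, ← map_mul, h2],
        by rw [mul_right_comm, h3], fun k hk => ?_⟩
      rcases Finset.mem_insert.mp hk with rfl | hk
      · rw [mul_assoc, ← map_mul, h3]
      · rw [mul_right_comm, h4 k hk]
  have := Fintype.ofFinite H
  obtain ⟨d', h1, h2, h3, h4⟩ := hfin Finset.univ
  let d := ∏ h : H, c h d₀
  have hd : d * d = d := by
    rw [← Finset.prod_mul_distrib]
    exact Finset.prod_congr rfl fun h _ => by rw [← map_mul, hd₀']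
  have hdd₀ : d * d₀ = d := by
    have : d₀ ∣ d := by
      have := Finset.dvd_prod_of_mem (fun h : H => c h d₀) (Finset.mem_univ 1)
      rwa [OneMemClass.coe_one, c1] at this
    obtain ⟨x, hx⟩ := this
    rw [hx, mul_right_comm, hd₀']
  have hd' : d' * d = d' := by
    have : ∀ s : Finset H, d' * ∏ h ∈ s, c h d₀ = d' := by
      classical
      intro s
      induction s using Finset.induction_on with
      | empty => simp
      | insert h s hs ih => rw [Finset.prod_insert hs, ← mul_assoc, h4 h (Finset.mem_univ _), ih]
    exact this _
  refine ⟨H, d, fun h => h1 (by rw [← hd', h, mul_zero]), hd, fun h hh => ?_, fun g hg => ?_,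
    fun e he he' hed h hh => ?_⟩
  · rw [map_prod]
    refine Fintype.prod_equiv (Equiv.mulLeft (⟨h, hh⟩ : H)) _ _ fun k => ?_
    rw [← cm]
    rfl
  · exact hle d hdd₀ (not_not.mp hg)
  · intro h'
    have : h ∈ T e := h'
    rw [hT e he he' (by rw [← hed, mul_assoc, hdd₀])] at this
    exact hh this

end TambaraFunctor

/-! ### Maps to the one-point set and to the free orbit -/

namespace FinGSet

variable {G : Type u} [Group G] [Finite G]

instance : Subsingleton (orbit (⊤ : Subgroup G)) :=
  (QuotientGroup.subsingleton_quotient_top : Subsingleton (G ⧸ (⊤ : Subgroup G)))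

/-- The map to the one-point `G`-set. -/
def toPoint (X : FinGSet G) : X →[G] orbit (⊤ : Subgroup G) where
  toFun _ := pt ⊤
  map_smul' _ _ := Subsingleton.elim _ _

theorem hom_point_ext {X : FinGSet G} (f g : X →[G] orbit (⊤ : Subgroup G)) : f = g := by
  ext x
  exact Subsingleton.elim _ _

theorem bijective_of_orbit_to_free {K : Subgroup G} (f : orbit K →[G] orbit (⊥ : Subgroup G)) :
    Function.Bijective f := by
  refine ⟨fun x y h => ?_, orbit_hom_surjective f⟩
  obtain ⟨a, rfl⟩ := exists_smul_eq_orbit x y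
  obtain ⟨b, hb⟩ := exists_smul_eq_orbit (pt ⊥) (f x)
  rw [map_smul, ← hb, ← mul_smul] at h
  have : a = 1 := by simpa using (smul_pt_bot_inj h).symm
  rw [this, one_smul]

end FinGSet

namespace TambaraFunctor

open FinGSet

variable {G : Type u} [Group G] [Finite G]

/-! ### Norms of idempotents with orthogonal translates -/

/-- An idempotent of `R(G/e)` that is invariant under `H` and orthogonal to its translates by
elements outside of `H`. -/
structure OrthogonalIdempotent (R : TambaraFunctor.{u, v} G) (H : Subgroup G) where
  d : R.obj (orbit (⊥ : Subgroup G))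
  idem : d * d = d
  res_eq : ∀ a b : orbit (⊥ : Subgroup G) →[G] orbit ⊥,
    (free (pt H)).comp a = (free (pt H)).comp b → R.res a d = R.res b d
  orth : ∀ a b : orbit (⊥ : Subgroup G) →[G] orbit ⊥,
    (free (pt H)).comp a ≠ (free (pt H)).comp b → R.res a d * R.res b d = 0

namespace OrthogonalIdempotent

variable {R : TambaraFunctor.{u, v} G} {H : Subgroup G} (D : OrthogonalIdempotent R H)

/-- The norm to `R(G/H)`. -/
def e : R.obj (orbit H) := R.nm (free (pt H)) D.d

theorem e_mul_e : D.e * D.e = D.e := by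
  rw [e, ← map_mul, D.idem]

theorem res_e_mul_res_e {X : FinGSet G} (b : X →[G] orbit H) :
    R.res b D.e * R.res b D.e = R.res b D.e := by
  rw [← map_mul, e_mul_e]

/-- The pullback of `G/e → G/H` along `g` is a union of free orbits. By `H`-invariance each
contributes the same factor to the restricted norm, and a product of equal idempotents is that
idempotent. -/
theorem res_e_eq_nm {L : Subgroup G} (g : orbit L →[G] orbit H) (v : orbit ⊥ →[G] orbit L)
    (r : orbit (⊥ : Subgroup G) →[G] orbit ⊥) (h : g.comp v = (free (pt H)).comp r) :
    R.res g D.e = R.nm v (R.res r D.d) := by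
  have h1 : R.nm v (R.res r D.d) * R.nm v (R.res r D.d) = R.nm v (R.res r D.d) := by
    rw [← map_mul, ← map_mul, D.idem]
  have h2 : R.nm v (R.res r D.d) ∣ R.res g D.e :=
    R.nm_dvd_res_nm _ _ _ _ (fun t => (DFunLike.congr_fun h t).symm)
      (fun s t e _ => (bijective_of_orbit_to_free r).1 e) _
  have h3 : R.nm v (R.res r D.d) * R.res g D.e = R.nm v (R.res r D.d) := by
    rw [e, R.res_nm _ _ _ _ (isCartesian_pullback (free (pt H)) g)]
    refine R.mul_nm_eq_self _ _ _ fun K k => ?_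
    -- The orbit `K` of the pullback maps to `G/e`, so it is free. Parametrizing it by a point over
    -- `v (pt ⊥)` turns its projection to `G/L` into `v`.
    obtain ⟨y, hy⟩ := orbit_hom_surjective ((pullbackSnd (free (pt H)) g).comp k) (v (pt ⊥))
    have hv : v = ((pullbackSnd (free (pt H)) g).comp k).comp (free y) := by
      rw [comp_free, hy, ← eq_free]
    have hα := bijective_of_orbit_to_free ((pullbackFst (free (pt H)) g).comp k)
    have hy' : Function.Bijective (free y) := by
      have := bijective_of_orbit_to_free (((pullbackFst (free (pt H)) g).comp k).comp (free y))
      exact (Function.Bijective.of_comp_iff' hα _).mp this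
    suffices hs : R.nm ((pullbackSnd (free (pt H)) g).comp k)
        (R.res k (R.res (pullbackFst (free (pt H)) g) D.d)) = R.nm v (R.res r D.d) by
      rw [hs, h1]
    rw [← R.nm_res_of_bijective _ hy' (R.res k _), ← R.nm_comp, ← hv, ← R.res_comp, ← R.res_comp]
    congr 1
    refine D.res_eq _ _ ?_
    rw [← h]
    ext x
    rw [hv]
    exact (isCartesian_pullback (free (pt H)) g).1 _
  -- The idempotent norm divides `R.res g D.e` by `h2` and absorbs it by `h3`, so the two agree.
  obtain ⟨y, hy⟩ := h2
  rw [hy, ← mul_assoc, h1] at h3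
  rw [hy, h3]

theorem res_free_e : R.res (free (pt H)) D.e = D.d := by
  rw [D.res_e_eq_nm (free (pt H)) (MulActionHom.id G) (MulActionHom.id G) rfl, R.res_id, R.nm_id]

theorem exists_lift (b : orbit ⊥ →[G] orbit H) :
    ∃ r : orbit (⊥ : Subgroup G) →[G] orbit ⊥, b = (free (pt H)).comp r := by
  obtain ⟨x, hx⟩ := orbit_hom_surjective (free (pt H)) (b (pt ⊥))
  exact ⟨free x, by rw [comp_free, hx, ← eq_free]⟩

theorem nm_free_res_e {L : Subgroup G} (g : orbit L →[G] orbit H) (v : orbit ⊥ →[G] orbit L) :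
    R.nm v (R.res (g.comp v) D.e) = R.res g D.e := by
  obtain ⟨r, hr⟩ := exists_lift (g.comp v)
  rw [D.res_e_eq_nm g v r hr, hr, R.res_comp, res_free_e]

theorem nm_orbit_res_e {K L : Subgroup G} (f : orbit K →[G] orbit L) (b : orbit L →[G] orbit H) :
    R.nm f (R.res (b.comp f) D.e) = R.res b D.e := by
  rw [← D.nm_free_res_e (b.comp f) (free (pt K)), ← R.nm_comp]
  exact D.nm_free_res_e b _

/-- On each orbit both factors are norms, along the same map from `G/e`, of translates of `d` by
elements of different cosets. These are orthogonal, and norms between orbits preserve zero. -/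
theorem res_e_mul_res_e_eq_zero {W : FinGSet G} (a b : W →[G] orbit H) (h : ∀ w, a w ≠ b w) :
    R.res a D.e * R.res b D.e = 0 := by
  refine ext_orbit fun K f => ?_
  obtain ⟨r, hr⟩ := exists_lift ((a.comp f).comp (free (pt K)))
  obtain ⟨r', hr'⟩ := exists_lift ((b.comp f).comp (free (pt K)))
  rw [map_mul, ← R.res_comp, ← R.res_comp, D.res_e_eq_nm _ _ r hr, D.res_e_eq_nm _ _ r' hr',
    ← map_mul, D.orth, nm_orbit_zero, map_zero]
  rw [← hr, ← hr']
  intro e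
  exact h _ (DFunLike.congr_fun e (pt ⊥))

/-- Over points with empty fibre the norm is `1`, so only absorption holds for general `f`. This is
the norm axiom of an `IdempotentFamily`. -/
theorem nm_res_e_mul {X Y : FinGSet G} (f : X →[G] Y) (b : Y →[G] orbit H) :
    R.nm f (R.res (b.comp f) D.e) * R.res b D.e = R.res b D.e := by
  refine ext_orbit fun K g => ?_
  rw [map_mul, R.res_nm _ _ _ _ (isCartesian_pullback f g), ← R.res_comp b g, mul_comm]
  refine R.mul_nm_eq_self _ _ _ fun L k => ?_
  have : R.res k (R.res (pullbackFst f g) (R.res (b.comp f) D.e)) =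
      R.res ((b.comp g).comp ((pullbackSnd f g).comp k)) D.e := by
    rw [← R.res_comp, ← R.res_comp]
    congr 2
    ext x
    exact congrArg b ((isCartesian_pullback f g).1 (k x))
  rw [this, nm_orbit_res_e, res_e_mul_res_e]

/-- A transfer along a map that is injective on the fibres of a map to `G / H` is recovered by
restricting and multiplying with the idempotent. -/
theorem res_tr_mul_res_e {W Y : FinGSet G} (f : W →[G] Y) (b : W →[G] orbit H)
    (h : ∀ w w', f w = f w' → b w = b w' → w = w') (y : R.obj W) (hy : y * R.res b D.e = y) :
    R.res f (R.tr f y) * R.res b D.e = y := by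
  let δ : W →[G] pullback f f :=
    pullbackLift f f (MulActionHom.id G) (MulActionHom.id G) fun _ => rfl
  have hδ : Function.Injective δ := fun w w' e => congrArg (fun p => p.1.1) e
  have h1 : (pullbackFst f f).comp δ = MulActionHom.id G := rfl
  have h2 : (pullbackSnd f f).comp δ = MulActionHom.id G := rfl
  -- Off the diagonal of `W ×_Y W` the two points have different images under `b`, so the
  -- idempotents are orthogonal there; only the diagonal contributes to the double coset formula.
  have h3 : R.res (complIncl δ)
      (R.res (pullbackFst f f) y * R.res (pullbackSnd f f) (R.res b D.e)) = 0 := by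
    conv_lhs => rw [← hy]
    rw [map_mul, map_mul, map_mul, mul_assoc, ← R.res_comp, ← R.res_comp, ← R.res_comp b,
      ← R.res_comp, ← R.res_comp, res_e_mul_res_e_eq_zero, mul_zero]
    intro w e
    have hw : w.1.1.1 = w.1.1.2 := h _ _ w.1.2 e
    exact w.2 w.1.1.1 (Subtype.ext (Prod.ext rfl hw))
  rw [R.res_tr _ _ _ _ (isCartesian_pullback f f), tr_mul,
    tr_eq_add (isDisjointUnion_compl δ hδ), h3, map_zero, add_zero, map_mul, ← R.res_comp,
    ← R.res_comp, h1, h2, R.tr_id, R.res_id, R.res_id, hy]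

/-- The transfer of the norm to `R(G/G)`. -/
def t : R.obj (orbit (⊤ : Subgroup G)) := R.tr (toPoint (orbit H)) D.e

theorem res_t_mul_e : R.res (toPoint (orbit H)) D.t * D.e = D.e := by
  have := D.res_tr_mul_res_e (toPoint (orbit H)) (MulActionHom.id G) (fun _ _ _ h => h) D.e
    (by rw [R.res_id, e_mul_e])
  rwa [R.res_id] at this

theorem res_t_mul_res_e {X : FinGSet G} (b : X →[G] orbit H) :
    R.res (toPoint X) D.t * R.res b D.e = R.res b D.e := by
  rw [hom_point_ext (toPoint X) ((toPoint (orbit H)).comp b), R.res_comp, ← map_mul, res_t_mul_e]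

theorem t_mul_t : D.t * D.t = D.t := by
  conv_lhs => rw [t, tr_mul, ← t, mul_comm, res_t_mul_e]
  rfl

/-- The restriction of `D.t` to `R(G/e)` as an invariant idempotent. -/
def total : OrthogonalIdempotent R (⊤ : Subgroup G) where
  d := R.res (toPoint _) D.t
  idem := by rw [← map_mul, t_mul_t]
  res_eq a b _ := by rw [← R.res_comp, ← R.res_comp]; rfl
  orth a b h := (h (hom_point_ext _ _)).elim

theorem total_mul_d : D.total.d * D.d = D.d := by
  have := D.res_t_mul_res_e (free (pt H))
  rwa [res_free_e] at this

/-! ### Complementary Tambara ideals of a `G`-invariant idempotent -/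

section Invariant

variable (D : OrthogonalIdempotent R (⊤ : Subgroup G))

theorem nm_res_toPoint {K L : Subgroup G} (f : orbit K →[G] orbit L) :
    R.nm f (R.res (toPoint _) D.e) = R.res (toPoint _) D.e :=
  D.nm_orbit_res_e f (toPoint _)

theorem res_res_toPoint {X Y : FinGSet G} (f : X →[G] Y) :
    R.res f (R.res (toPoint _) D.e) = R.res (toPoint _) D.e := by
  rw [← R.res_comp]
  rfl

/-- The Tambara ideal generated by the norm of an invariant idempotent. -/
def fixedIdeal : TambaraIdeal R where
  ideal K :=
    { carrier := {x | x * R.res (toPoint _) D.e = x}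
      add_mem' := fun {a b} ha hb => by
        change (a + b) * _ = a + b
        rw [add_mul, show a * _ = a from ha, show b * _ = b from hb]
      zero_mem' := zero_mul _
      smul_mem' := fun c x hx => by
        change c * x * _ = c * x
        rw [mul_assoc, show x * _ = x from hx] }
  res_mem f a ha := by
    change R.res f a * _ = R.res f a
    rw [← D.res_res_toPoint f, ← map_mul, show a * _ = a from ha]
  tr_mem f a ha := by
    change R.tr f a * _ = R.tr f a
    rw [tr_mul, D.res_res_toPoint f, show a * _ = a from ha]
  nm_mem f a ha := by
    change R.nm f a * _ = R.nm f a
    rw [← D.nm_res_toPoint f, ← map_mul, show a * _ = a from ha]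

/-- The annihilator of the norm of an invariant idempotent. -/
def annIdeal : TambaraIdeal R where
  ideal K :=
    { carrier := {x | x * R.res (toPoint _) D.e = 0}
      add_mem' := fun {a b} ha hb => by
        change (a + b) * _ = 0
        rw [add_mul, show a * _ = 0 from ha, show b * _ = 0 from hb, add_zero]
      zero_mem' := zero_mul _
      smul_mem' := fun c x hx => by
        change c * x * _ = 0
        rw [mul_assoc, show x * _ = 0 from hx, mul_zero] }
  res_mem f a ha := by
    change R.res f a * _ = 0
    rw [← D.res_res_toPoint f, ← map_mul, show a * _ = 0 from ha, map_zero]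
  tr_mem f a ha := by
    change R.tr f a * _ = 0
    rw [tr_mul, D.res_res_toPoint f, show a * _ = 0 from ha, map_zero]
  nm_mem f a ha := by
    change R.nm f a * _ = 0
    rw [← D.nm_res_toPoint f, ← map_mul, show a * _ = 0 from ha, nm_orbit_zero]

/-- The only invariant idempotents of `R(G/e)` for a domain-like `R` are `0` and `1`. -/
theorem d_eq_one_of_isDomainLike (h : R.IsDomainLike) (hd : D.d ≠ 0) : D.d = 1 := by
  rw [isDomainLike_iff] at h
  have hs : R.res (toPoint _) D.e = D.d := by
    rw [hom_point_ext (toPoint _) (free (pt ⊤)), res_free_e]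
  have hmul : D.fixedIdeal * D.annIdeal ≤ ⊥ := by
    rw [TambaraIdeal.mul_le_iff]
    intro K a ha b hb
    rw [TambaraIdeal.mem_bot, ← show a * _ = a from ha, mul_assoc, mul_comm _ b,
      show b * _ = 0 from hb, mul_zero]
  rcases h.2 D.fixedIdeal D.annIdeal hmul with h | h
  · refine (hd (h ⊥ (show D.d * _ = D.d from ?_))).elim
    rw [hs, D.idem]
  · have : 1 - D.d = 0 := h ⊥ (show (1 - D.d) * _ = 0 from by
      rw [hs, sub_mul, one_mul, D.idem, sub_self])
    exact (sub_eq_zero.mp this).symm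

end Invariant

/-- If `L` fixes the point `k (pt ⊥)`, then `k` factors through `G/L` and the norm is a restriction
of `e`, which `t` absorbs. Otherwise the norm vanishes. -/
theorem res_t_mul_nm {L : Subgroup G} (k : orbit ⊥ →[G] orbit H) :
    R.res (toPoint _) D.t * R.nm (free (pt L)) (R.res k D.e) =
      R.nm (free (pt L)) (R.res k D.e) := by
  by_cases hL : L ≤ MulAction.stabilizer G (k (pt ⊥))
  · have : k = (orbitTo L (k (pt ⊥)) hL).comp (free (pt L)) := by
      rw [comp_free, orbitTo_pt, ← eq_free]
    rw [this, nm_free_res_e, res_t_mul_res_e]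
  · obtain ⟨l, hl, hl'⟩ := SetLike.not_le_iff_exists.mp hL
    let a : orbit (⊥ : Subgroup G) →[G] orbit ⊥ := free (l • pt ⊥)
    have ha : (free (pt L)).comp a = free (pt L) := by
      rw [comp_free, map_smul, free_pt]
      congr 1
      conv_rhs => rw [← one_smul G (pt L)]
      rw [smul_pt_eq_iff]
      simpa using hl
    have h0 : R.nm (free (pt L)) (R.res k D.e) = R.nm (free (pt L)) (R.res (k.comp a) D.e) := by
      rw [R.res_comp]
      conv_rhs => rw [← ha, R.nm_comp, R.nm_res_of_bijective a (bijective_of_orbit_to_free a)]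
    -- Translating by `l` does not change the norm but moves `k` pointwise. So the norm equals its
    -- own square, which is the norm of a product of orthogonal elements.
    have : R.nm (free (pt L)) (R.res k D.e) = 0 := by
      have := congrArg (R.nm (free (pt L)) (R.res k D.e) * ·) h0
      rw [← map_mul, ← map_mul, e_mul_e, ← map_mul] at this
      rw [this, res_e_mul_res_e_eq_zero, nm_orbit_zero]
      intro w hw
      obtain ⟨g, rfl⟩ := exists_smul_eq_orbit (pt ⊥) w
      rw [map_smul, map_smul] at hw
      have hw' := smul_left_cancel g hw
      rw [MulActionHom.comp_apply, free_pt, map_smul] at hw'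
      exact hl' hw'.symm
    rw [this, mul_zero]

theorem t_eq_one (h : D.total.d = 1) : D.t = 1 := by
  let c := toPoint (orbit H)
  let π := toPoint (orbit (⊥ : Subgroup G))
  let p := pullbackSnd c π
  have hexp := isExponential_depProd p π
  -- By hypothesis `1` in `R(G/e)` is the restriction of `t`, a transfer of restrictions of `e`. Its
  -- norm to `G/G` is `1`, and the exponential formula makes this a transfer of norms; by Frobenius
  -- reciprocity `t` need only absorb these norms.
  have h1 : (1 : R.obj (orbit (⊤ : Subgroup G))) = R.tr (depProdBase p π)
      (R.nm (depProdEvalSnd p π) (R.res ((pullbackFst c π).comp (depProdEvalFst p π)) D.e)) := by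
    rw [R.res_comp, ← R.nm_tr _ _ _ _ _ hexp, ← R.res_tr _ _ _ _ (isCartesian_pullback c π)]
    rw [show R.res π (R.tr c D.e) = 1 from h, map_one]
  rw [← mul_one D.t, h1, mul_tr]
  congr 1
  refine ext_orbit fun L k => ?_
  -- One free orbit of the evaluation set over `G/L` yields a divisor of the norm, and it is enough
  -- that `t` absorbs this divisor.
  obtain ⟨w, ⟨-, hw⟩, -⟩ := hexp.1.2 (pt ⊥) (k (pt L)) (Subsingleton.elim _ _)
  obtain ⟨y, hy⟩ := R.nm_dvd_res_nm (depProdEvalSnd p π) k (free w) (free (pt L))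
    (fun t => by
      have : (depProdEvalSnd p π).comp (free w) = k.comp (free (pt L)) := by
        rw [comp_free, comp_free, hw]
      exact DFunLike.congr_fun this t)
    (fun s t e _ => (bijective_of_orbit_to_free
      ((p.comp (depProdEvalFst p π)).comp (free w))).1
        (congrArg (p.comp (depProdEvalFst p π)) e))
    (R.res ((pullbackFst c π).comp (depProdEvalFst p π)) D.e)
  rw [map_mul, hy, ← mul_assoc, ← R.res_comp, ← R.res_comp,
    hom_point_ext ((depProdBase p π).comp k) (toPoint _), res_t_mul_nm]

end OrthogonalIdempotent

end TambaraFunctor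

namespace TambaraFunctor

open FinGSet

variable {G : Type u} [Group G] [Finite G]

/-! ### The coinduction decomposition -/

namespace OrthogonalIdempotent

variable {R : TambaraFunctor.{u, v} G} {H : Subgroup G} (D : OrthogonalIdempotent R H)

/-- The restrictions of the norm, as a family of idempotents over the subgroup `H`. -/
noncomputable def family : IdempotentFamily (R.restrictGroup H) where
  e X := R.res (induceBase X) D.e
  idem X := D.res_e_mul_res_e (induceBase X)
  res_e f := (R.res_comp (induceBase _) (induceMap f) D.e).symm
  nm_e f := D.nm_res_e_mul (induceMap f) (induceBase _)

/-- This is the base change of `t = 1` along the map from `X` to the point. -/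
theorem tr_induceCounit_res_e (h : D.t = 1) (X : FinGSet G) :
    R.tr (induceCounit H X) (R.res (induceBase (restrict H X)) D.e) = 1 := by
  rw [← R.res_tr _ _ _ _ (isCartesian_induceBase X (toPoint (orbit H)) (toPoint X))]
  change R.res _ D.t = 1
  rw [h, map_one]

theorem res_tr_induceCounit (X : FinGSet G) (y : R.obj (induce H (restrict H X)))
    (hy : y * R.res (induceBase (restrict H X)) D.e = y) :
    R.res (induceCounit H X) (R.tr (induceCounit H X) y) *
      R.res (induceBase (restrict H X)) D.e = y := by
  refine D.res_tr_mul_res_e _ _ ?_ y hy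
  rintro ⟨c, x⟩ ⟨c', x'⟩ h hc
  obtain rfl : c = c' := hc
  have h' : c.out • (show X.carrier from x) = c.out • (show X.carrier from x') := h
  exact Prod.ext rfl (smul_left_cancel (α := G) (β := X.carrier) c.out h')

/-- The value at `X` of the isomorphism with the functor coinduced from the corner. -/
noncomputable def coindEquivObj (h : D.t = 1) (X : FinGSet G) :
    R.obj X ≃+* D.family.corner.obj (restrict H X) where
  toFun x := (D.family.idem (restrict H X)).toCorner
    (R.res (induceCounit H X) x * R.res (induceBase (restrict H X)) D.e)
    ((mul_assoc _ _ _).trans (congrArg _ (D.res_e_mul_res_e _)))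
  invFun y := R.tr (induceCounit H X) y.1
  left_inv x := by
    change R.tr (induceCounit H X)
      (R.res (induceCounit H X) x * R.res (induceBase (restrict H X)) D.e) = x
    rw [← mul_tr, tr_induceCounit_res_e D h, mul_one]
  right_inv y := D.family.corner_ext (D.res_tr_induceCounit X y.1 (D.family.corner_mul_e y))
  map_mul' x y := D.family.corner_ext (by
    change R.res (induceCounit H X) (x * y) * R.res (induceBase (restrict H X)) D.e =
      R.res (induceCounit H X) x * R.res (induceBase (restrict H X)) D.e *
        (R.res (induceCounit H X) y * R.res (induceBase (restrict H X)) D.e)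
    rw [mul_mul_mul_comm, res_e_mul_res_e, map_mul])
  map_add' x y := D.family.corner_ext (by
    change R.res (induceCounit H X) (x + y) * R.res (induceBase (restrict H X)) D.e =
      R.res (induceCounit H X) x * R.res (induceBase (restrict H X)) D.e +
        R.res (induceCounit H X) y * R.res (induceBase (restrict H X)) D.e
    rw [map_add, add_mul])

/-- A Tambara functor with a complete orthogonal idempotent is coinduced from the corner. -/
noncomputable def isoCoind (h : D.t = 1) : Iso R (coind H D.family.corner) where
  equiv := D.coindEquivObj h
  map_res {X Y} f a := D.family.corner_ext (by
    change R.res (induceCounit H X) (R.res f a) * R.res (induceBase (restrict H X)) D.e =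
      R.res (induceMap (restrictMap H f))
        (R.res (induceCounit H Y) a * R.res (induceBase (restrict H Y)) D.e)
    rw [map_mul, ← R.res_comp, ← R.res_comp, ← R.res_comp]
    congr 3
    ext z
    exact (isCartesian_induceCounit f).1 z)
  map_tr {X Y} f a := D.family.corner_ext (by
    change R.res (induceCounit H Y) (R.tr f a) * R.res (induceBase (restrict H Y)) D.e =
      R.tr (induceMap (restrictMap H f))
        (R.res (induceCounit H X) a * R.res (induceBase (restrict H X)) D.e)
    rw [R.res_tr _ _ _ _ (isCartesian_induceCounit f), tr_mul, ← R.res_comp]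
    rfl)
  map_nm {X Y} f a := D.family.corner_ext (by
    change R.res (induceCounit H Y) (R.nm f a) * R.res (induceBase (restrict H Y)) D.e =
      R.nm (induceMap (restrictMap H f))
        (R.res (induceCounit H X) a * R.res (induceBase (restrict H X)) D.e) *
          R.res (induceBase (restrict H Y)) D.e
    rw [R.res_nm _ _ _ _ (isCartesian_induceCounit f)]
    exact (D.family.nm_mul_e (restrictMap H f) _).symm)

/-! ### Comparison of `G/e` with `G ×_H (H/e)`, and clarity of the corner -/

variable (H) in
/-- The base point of the `G`-set induced from the free `H`-orbit. -/
noncomputable def inducePt : induce H (orbit (⊥ : Subgroup H)) :=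
  induceUnit (orbit (⊥ : Subgroup H)) (pt ⊥)

variable (H) in
/-- The isomorphism of the free `G`-orbit with the `G`-set induced from the free `H`-orbit. -/
noncomputable def freeToInduce : orbit (⊥ : Subgroup G) →[G] induce H (orbit (⊥ : Subgroup H)) :=
  free (inducePt H)

theorem freeToInduce_smul_pt (h : H) :
    freeToInduce H ((h : G) • pt ⊥) = induceUnit (orbit (⊥ : Subgroup H)) (h • pt ⊥) := by
  rw [map_smul, map_smul, freeToInduce, free_pt]
  rfl

theorem freeToInduce_pt : freeToInduce H (pt ⊥) = inducePt H := free_pt _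

/-- Injectivity holds because a composite with a map back to `G/e` is bijective. For surjectivity,
`H` reaches every point over the trivial coset and `G` moves the other cosets there. -/
theorem freeToInduce_bijective : Function.Bijective (freeToInduce H) := by
  constructor
  · have := bijective_of_orbit_to_free ((induceLift (Y := orbit (⊥ : Subgroup G))
      (free (pt (⊥ : Subgroup G) : restrict H (orbit (⊥ : Subgroup G))))).comp (freeToInduce H))
    exact fun x y h => this.1 (congrArg (induceLift _) h)
  · have key (x : orbit (⊥ : Subgroup H)) :
        ∃ y, freeToInduce H y = ((((1 : G) : G ⧸ H), x) : (G ⧸ H) × orbit (⊥ : Subgroup H)) := by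
      obtain ⟨h, hh⟩ := exists_smul_eq_orbit (pt ⊥) (baseRep H • x)
      refine ⟨(h : G) • pt ⊥, (freeToInduce_smul_pt h).trans ?_⟩
      rw [hh]
      exact Prod.ext rfl (inv_smul_smul (baseRep H) x)
    intro w
    obtain ⟨g, hg⟩ := exists_smul_eq_orbit (w.1 : orbit H) (pt H)
    obtain ⟨y, hy⟩ := key (g • w).2
    refine ⟨g⁻¹ • y, ?_⟩
    rw [map_smul, inv_smul_eq_iff, hy]
    exact Prod.ext hg.symm rfl

theorem induceMap_rightMul_comp (h : H) :
    (induceMap (rightMul h)).comp (freeToInduce H) = (freeToInduce H).comp (rightMul (h : G)) := by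
  refine orbit_hom_ext (pt ⊥) ?_
  rw [rightMul_eq_free, rightMul_eq_free, MulActionHom.comp_apply, MulActionHom.comp_apply,
    free_pt, freeToInduce_smul_pt, freeToInduce_pt]
  refine ((isCartesian_induceUnit (free (h • pt (⊥ : Subgroup H)))).1 (pt ⊥)).trans ?_
  rw [free_pt]

/-- The value of the corner at `H/e` is carried into `d R(G/e)`, compatibly with the action of `H`.
An offending idempotent would thus give one below `d`. -/
theorem isClarified_corner (hD : ∀ d' : R.obj (orbit (⊥ : Subgroup G)), d' ≠ 0 → d' * d' = d' →
    d' * D.d = d' → ∀ h ∈ H, d' * R.conjAct h d' ≠ 0) : D.family.corner.IsClarified := by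
  rintro ⟨δ, h0, hi, h, hh⟩
  obtain ⟨x, hx⟩ : ∃ x : R.obj (induce H (orbit ⊥)), x = δ.1 := ⟨_, rfl⟩
  have hx0 : x ≠ 0 := fun e => h0 (D.family.corner_ext (hx.symm.trans e))
  have hxx : x * x = x := by
    subst hx
    exact congrArg Subtype.val hi
  have hxe : x * R.res (induceBase (orbit ⊥)) D.e = x := by
    subst hx
    exact D.family.corner_mul_e δ
  have hxh : x * R.res (induceMap (rightMul h)) x = 0 := by
    subst hx
    exact congrArg Subtype.val hh
  have h1 : (induceBase (orbit (⊥ : Subgroup H))).comp (freeToInduce H) = free (pt H) := by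
    rw [freeToInduce, comp_free]
    rfl
  refine hD (R.res (freeToInduce H) x) (fun e => hx0 ?_) ?_ ?_ h h.2 ?_
  · refine R.res_injective_of_bijective _ freeToInduce_bijective ?_
    rw [e, map_zero]
  · rw [← map_mul, hxx]
  · rw [← res_free_e, ← h1, R.res_comp, ← map_mul, hxe]
  · rw [conjAct, ← R.res_comp, ← induceMap_rightMul_comp, R.res_comp, ← map_mul, hxh, map_zero]

end OrthogonalIdempotent

/-! ### The action of `G` on `R(G/e)` and the theorem -/

theorem rightMul_pt (g : G) : rightMul g (pt ⊥) = g • pt ⊥ := by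
  rw [rightMul_eq_free, free_pt]

/-- The action of `G` on `R(G/e)`. -/
def conjHom (R : TambaraFunctor.{u, v} G) :
    G →* (R.obj (orbit (⊥ : Subgroup G)) →+* R.obj (orbit (⊥ : Subgroup G))) where
  toFun := R.conjAct
  map_one' := by
    ext x
    have : rightMul (1 : G) = MulActionHom.id G :=
      orbit_hom_ext (pt ⊥) (by rw [rightMul_pt, one_smul]; rfl)
    rw [conjAct, this]
    exact R.res_id x
  map_mul' g h := by
    ext x
    have : rightMul (g * h) = (rightMul h).comp (rightMul g) :=
      orbit_hom_ext (pt ⊥) (by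
        rw [MulActionHom.comp_apply, rightMul_pt, rightMul_pt, map_smul, rightMul_pt, mul_smul])
    rw [conjAct, this]
    exact R.res_comp _ _ x

theorem exists_eq_rightMul (a : orbit (⊥ : Subgroup G) →[G] orbit (⊥ : Subgroup G)) :
    ∃ g, a = rightMul g := by
  obtain ⟨g, hg⟩ := exists_smul_eq_orbit (pt ⊥) (a (pt ⊥))
  exact ⟨g, orbit_hom_ext (pt ⊥) (by rw [rightMul_pt, hg])⟩

/-- This translates conditions on elements of `G` into the conditions on self-maps of `G/e` in
`OrthogonalIdempotent`. -/
theorem free_comp_rightMul_eq_iff (H : Subgroup G) (a b : G) :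
    (free (pt H)).comp (rightMul a) = (free (pt H)).comp (rightMul b) ↔ a⁻¹ * b ∈ H := by
  rw [← smul_pt_eq_iff]
  have h (c : G) : ((free (pt H)).comp (rightMul c)) (pt ⊥) = c • pt H := by
    rw [MulActionHom.comp_apply, rightMul_pt, map_smul, free_pt]
  rw [← h, ← h]
  exact ⟨fun e => by rw [e], orbit_hom_ext _⟩

/-- An idempotent that is invariant under `H` and orthogonal to its translates outside of `H`. -/
def OrthogonalIdempotent.ofConj {R : TambaraFunctor.{u, v} G} (H : Subgroup G)
    (d : R.obj (orbit (⊥ : Subgroup G))) (idem : d * d = d) (inv : ∀ h ∈ H, R.conjHom h d = d)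
    (orth : ∀ g ∉ H, d * R.conjHom g d = 0) : OrthogonalIdempotent R H where
  d := d
  idem := idem
  res_eq a b h := by
    obtain ⟨g, rfl⟩ := exists_eq_rightMul a
    obtain ⟨k, rfl⟩ := exists_eq_rightMul b
    rw [free_comp_rightMul_eq_iff] at h
    change R.conjHom g d = R.conjHom k d
    conv_lhs => rw [← inv _ h]
    rw [← mul_inv_cancel_left g k, map_mul (R.conjHom) g, inv_mul_cancel_left]
    rfl
  orth a b h := by
    obtain ⟨g, rfl⟩ := exists_eq_rightMul a
    obtain ⟨k, rfl⟩ := exists_eq_rightMul b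
    rw [Ne, free_comp_rightMul_eq_iff] at h
    change R.conjHom g d * R.conjHom k d = 0
    rw [← mul_inv_cancel_left g k, map_mul (R.conjHom) g]
    change _ * R.conjHom g (R.conjHom (g⁻¹ * k) d) = 0
    rw [← map_mul, orth _ h, map_zero]

/-- Norms between orbits preserve both `0` and `1`, so `R(G/e) = 0` would make every level zero. -/
theorem IsDomainLike.nontrivial {R : TambaraFunctor.{u, v} G} (h : R.IsDomainLike) :
    Nontrivial (R.obj (orbit (⊥ : Subgroup G))) := by
  rw [isDomainLike_iff] at h
  obtain ⟨⟨K, hK⟩, -⟩ := h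
  by_contra hn
  rw [not_nontrivial_iff_subsingleton] at hn
  refine hK ?_
  rw [← map_one (R.nm (free (pt K))), Subsingleton.elim (1 : R.obj (orbit ⊥)) 0, nm_orbit_zero]

end TambaraFunctor

theorem mainTheorem8 {G : Type u} [Group G] [Finite G] (R : TambaraFunctor.{u, v} G) :
    R.IsDomainLike ↔
      ∃ (H : Subgroup G) (S : TambaraFunctor.{u, v} H),
        S.IsClarified ∧ S.IsDomainLike ∧
          Nonempty (TambaraFunctor.Iso R (TambaraFunctor.coind H S)) := by
  constructor
  · intro h
    have := h.nontrivial
    obtain ⟨H, d, hd, idem, inv, orth, hmin⟩ :=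
      TambaraFunctor.exists_idempotent_with_orthogonal_translates R.conjHom
    let D := TambaraFunctor.OrthogonalIdempotent.ofConj H d idem inv orth
    -- The invariant idempotent `D.total.d` is nonzero because it lies above `d`.
    have ht : D.t = 1 := D.t_eq_one (D.total.d_eq_one_of_isDomainLike h fun e => hd (by
      have := D.total_mul_d
      rw [e, zero_mul] at this
      exact this.symm))
    exact ⟨H, D.family.corner, D.isClarified_corner hmin,
      TambaraFunctor.isDomainLike_of_coind (D.isoCoind ht) h, ⟨D.isoCoind ht⟩⟩
  · rintro ⟨H, S, -, hS, ⟨Φ⟩⟩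
    exact TambaraFunctor.isDomainLike_coind Φ hS
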